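/- Let $\mathbb F_N^+$ be the free unital semigroup on $N$ generators $g_1,\dots,g_N$ (words $\sigma$, with the empty word as unit), with the involution $\mathfrak I$ that reads words backwards. Let $\mathcal P_N^0$ be the algebra of complex polynomials $P=\sum_\sigma c_\sigma Y_\sigma$ in $N$ non-commuting indeterminates, with $Y_\sigma Y_\tau=Y_{\sigma\tau}$ and the involution $P^*=\sum_\sigma \overline{c_\sigma}\,Y_{\mathfrak I(\sigma)}$. A Kreĭn space is a Hilbert space $\mathcal K$ with a fundamental symmetry $J=J^*=J^{-1}$ and the indefinite inner product $[x,y]=\langle Jx,y\rangle$; a bounded operator $U$ between Kreĭn spaces is unitary if it is bijective and preserves the indefinite inner products. GNS data of a linear functional $Z$ on $\mathcal P_N^0$ is a triple $(\pi,\mathcal K,\Omega)$, where $\mathcal K$ is a Kreĭn space, $\pi$ is a representation of $\mathcal P_N^0$ by closable operators on a dense, invariant domain $\mathcal D(\pi)\subset\mathcal K$ which is hermitian, i.e. $[\pi(P)x,y]=[x,\pi(P^*)y]$ for $x,y\in\mathcal D(\pi)$, and $\Omega\in\mathcal D(\pi)$ satisfies $Z(P)=[\pi(P)\Omega,\Omega]$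 for all $P$ and $\mathcal D(\pi)=\operatorname{span}\{\pi(P)\Omega : P\in\mathcal P_N^0\}$. A GNS functional is a hermitian functional ($Z(P^*)=\overline{Z(P)}$) that has GNS data; its moments are the numbers $Z(Y_\sigma)$. Two GNS data $(\pi_1,\mathcal K_1,\Omega_1)$, $(\pi_2,\mathcal K_2,\Omega_2)$ are unitarily equivalent if there is a unitary operator $\Phi:\mathcal K_1\to\mathcal K_2$ of Kreĭn spaces with $\Phi\Omega_1=\Omega_2$, $\Phi\mathcal D(\pi_1)=\mathcal D(\pi_2)$ and $\Phi\pi_1(P)x=\pi_2(P)\Phi x$ for all $P\in\mathcal P_N^0$, $x\in\mathcal D(\pi_1)$. For a kernel $K:\mathbb F_N^+\times\mathbb F_N^+\to\mathbb C$ and finitely supported $f,g:\mathbb F_N^+\to\mathbb C$ put $[f,g]_K=\sum_{\sigma,\tau}K(\sigma,\tau)f(\tau)\overline{g(\sigma)}$. The kernel $K$ is hermitian if $K(\sigma,\tau)=\overline{K(\tau,\sigma)}$; a hermitian kernel $L$ is positive definite if $[f,f]_L\ge 0$ for all $f$; for hermitian kernels, $A\le B$ means $[f,f]_A\le[f,f]_B$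 for all $f$. If $L$ is positive definite and $-L\le K\le L$, let $\mathcal H_L$ be the Hilbert space obtained by completing the quotient of the space of finitely supported functions by $\{f:[f,f]_L=0\}$ with respect to $[\cdot,\cdot]_L$; the Gram operator $A_L$ of $K$ with respect to $L$ is the bounded operator on $\mathcal H_L$ with $[f,g]_K=[A_Lf,g]_L$ for all finitely supported $f,g$. Let $\rho(A_L)$ be its resolvent set. **Theorem.** Let $s_\sigma$, $\sigma\in\mathbb F_N^+$, be the moments of some GNS functional on $\mathcal P_N^0$, and let $K(\sigma,\tau)=s_{\mathfrak I(\sigma)\tau}$. Then the following are equivalent: (1) There exists a unique GNS functional on $\mathcal P_N^0$ with moments $s_\sigma$, uniqueness being understood for the functional together with its GNS data, that is: there is exactly one GNS functional with moments $s_\sigma$, and all its GNS data are unitarily equivalent. (2) For each positive definite kernel $L$ on $\mathbb F_N^+$ such that $-L\le K\le L$ there exists $\varepsilon>0$ such that either $(0,\varepsilon)\subset\rho(A_L)$ or $(-\varepsilon,0)\subset\rho(A_L)$. -/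

import Mathlib

open scoped InnerProductSpace ComplexConjugate

namespace KreinMoment

noncomputable section

/-! ### Extension of bounded sesquilinear forms to the completion -/

section Extension

open UniformSpace

variable {E : Type*} [SeminormedAddCommGroup E] [InnerProductSpace ℂ E]

lemma denseRange_toComplL : DenseRange (Completion.toComplL (𝕜 := ℂ) (E := E)) :=
  Completion.denseRange_coe

lemma isUniformInducing_toComplL : IsUniformInducing (Completion.toComplL (𝕜 := ℂ) (E := E)) :=
  Completion.isUniformInducing_coe _

lemma norm_extend_le (φ : E →L[ℂ] ℂ) :
    ‖φ.extend (Completion.toComplL (𝕜 := ℂ) (E := E))‖ ≤ 1 * ‖φ‖ := by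
  rw [one_mul]
  refine ContinuousLinearMap.opNorm_le_bound _ (norm_nonneg φ) fun x => ?_
  induction x using Completion.induction_on with
  | hp => exact isClosed_le (by fun_prop) (by fun_prop)
  | ih x =>
    have e : (φ.extend (Completion.toComplL (𝕜 := ℂ) (E := E))) (x : Completion E) = φ x :=
      ContinuousLinearMap.extend_eq φ denseRange_toComplL isUniformInducing_toComplL x
    rw [e, Completion.norm_coe]
    exact φ.le_opNorm x

/-- Extension by continuity of bounded functionals to the completion. -/
def extendFunctional : (E →L[ℂ] ℂ) →L[ℂ] (Completion E →L[ℂ] ℂ) :=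
  LinearMap.mkContinuous
    { toFun := fun φ : E →L[ℂ] ℂ => φ.extend (Completion.toComplL (𝕜 := ℂ) (E := E))
      map_add' := fun φ ψ => by
        refine ContinuousLinearMap.extend_unique _ denseRange_toComplL
          isUniformInducing_toComplL _ ?_
        refine ContinuousLinearMap.ext fun f => ?_
        rw [ContinuousLinearMap.comp_apply, _root_.add_apply,
          ContinuousLinearMap.extend_eq _ denseRange_toComplL isUniformInducing_toComplL,
          ContinuousLinearMap.extend_eq _ denseRange_toComplL isUniformInducing_toComplL,
          _root_.add_apply]
      map_smul' := fun c φ => by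
        refine ContinuousLinearMap.extend_unique _ denseRange_toComplL
          isUniformInducing_toComplL _ ?_
        refine ContinuousLinearMap.ext fun f => ?_
        rw [ContinuousLinearMap.comp_apply, _root_.smul_apply,
          ContinuousLinearMap.extend_eq _ denseRange_toComplL isUniformInducing_toComplL,
          _root_.smul_apply, RingHom.id_apply] }
    1 norm_extend_le

/-- Extension by continuity of bounded sesquilinear forms to the completion. -/
def extendForm (B : E →L⋆[ℂ] E →L[ℂ] ℂ) : Completion E →L⋆[ℂ] Completion E →L[ℂ] ℂ :=
  (extendFunctional.comp B).extend (Completion.toComplL (𝕜 := ℂ) (E := E))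

lemma extendForm_coe (B : E →L⋆[ℂ] E →L[ℂ] ℂ) (x y : E) :
    extendForm B (x : Completion E) (y : Completion E) = B x y := by
  have e1 : extendForm B (x : Completion E) = extendFunctional (B x) :=
    ContinuousLinearMap.extend_eq _ denseRange_toComplL isUniformInducing_toComplL x
  rw [e1]
  exact ContinuousLinearMap.extend_eq (B x) denseRange_toComplL isUniformInducing_toComplL y

end Extension

/-! ### Scalar hermitian kernels and their Gram operators -/

section Kernels

variable {X : Type*}

/-- The inner product `[f, g]_K = ∑_{x, y} K(x, y) f(y) conj (g(x))` which a scalar kernel `K`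
induces on the finitely supported functions on `X`. -/
def kernelForm (K : X → X → ℂ) (f g : X →₀ ℂ) : ℂ :=
  f.sum fun y a => g.sum fun x b => K x y * a * conj b

/-- Hermitian kernels: `K(x, y) = conj (K(y, x))`. -/
def IsHermitianKernel (K : X → X → ℂ) : Prop :=
  ∀ x y, K x y = conj (K y x)

/-- Positive definite kernels: hermitian kernels for which `[f, f]_L` (a real number) is always
nonnegative. -/
def IsPosDefKernel (L : X → X → ℂ) : Prop :=
  IsHermitianKernel L ∧ ∀ f : X →₀ ℂ, 0 ≤ (kernelForm L f f).re

/-- The partial order on the set of hermitian kernels: `A ≤ B` means `[f, f]_A ≤ [f, f]_B` for all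
finitely supported `f` (both sides are real numbers). -/
def KernelLE (A B : X → X → ℂ) : Prop :=
  IsHermitianKernel A ∧ IsHermitianKernel B ∧
    ∀ f : X →₀ ℂ, (kernelForm A f f).re ≤ (kernelForm B f f).re

lemma kernelForm_add_left (K : X → X → ℂ) (f f' g : X →₀ ℂ) :
    kernelForm K (f + f') g = kernelForm K f g + kernelForm K f' g := by
  classical
  unfold kernelForm
  refine Finsupp.sum_add_index' ?_ ?_
  · intro y; simp
  · intro y a a'
    rw [← Finsupp.sum_add]
    refine Finsupp.sum_congr fun x _ => ?_
    ring

lemma kernelForm_smul_left (K : X → X → ℂ) (c : ℂ) (f g : X →₀ ℂ) :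
    kernelForm K (c • f) g = c * kernelForm K f g := by
  classical
  unfold kernelForm
  rw [Finsupp.sum_smul_index' (by intro y; simp), Finsupp.mul_sum]
  refine Finsupp.sum_congr fun y _ => ?_
  rw [Finsupp.mul_sum]
  refine Finsupp.sum_congr fun x _ => ?_
  simp only [smul_eq_mul]
  ring

lemma kernelForm_conj {K : X → X → ℂ} (hK : IsHermitianKernel K) (f g : X →₀ ℂ) :
    conj (kernelForm K f g) = kernelForm K g f := by
  classical
  unfold kernelForm
  simp only [Finsupp.sum, map_sum, map_mul, Complex.conj_conj]
  rw [Finset.sum_comm]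
  refine Finset.sum_congr rfl fun x _ => Finset.sum_congr rfl fun y _ => ?_
  rw [hK x y, Complex.conj_conj]
  ring

lemma kernelForm_add_right {K : X → X → ℂ} (hK : IsHermitianKernel K) (f g g' : X →₀ ℂ) :
    kernelForm K f (g + g') = kernelForm K f g + kernelForm K f g' := by
  rw [← kernelForm_conj hK, kernelForm_add_left, map_add, kernelForm_conj hK, kernelForm_conj hK]

lemma kernelForm_smul_right {K : X → X → ℂ} (hK : IsHermitianKernel K) (c : ℂ) (f g : X →₀ ℂ) :
    kernelForm K f (c • g) = conj c * kernelForm K f g := by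
  rw [← kernelForm_conj hK, kernelForm_smul_left, map_mul, kernelForm_conj hK]

lemma kernelForm_kernel_add (K L : X → X → ℂ) (f g : X →₀ ℂ) :
    kernelForm (K + L) f g = kernelForm K f g + kernelForm L f g := by
  unfold kernelForm
  simp only [Finsupp.sum, ← Finset.sum_add_distrib, Pi.add_apply]
  refine Finset.sum_congr rfl fun x _ => Finset.sum_congr rfl fun y _ => ?_
  ring

lemma kernelForm_kernel_neg (K : X → X → ℂ) (f g : X →₀ ℂ) :
    kernelForm (-K) f g = -kernelForm K f g := by
  unfold kernelForm
  simp only [Finsupp.sum, ← Finset.sum_neg_distrib, Pi.neg_apply]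
  refine Finset.sum_congr rfl fun x _ => Finset.sum_congr rfl fun y _ => ?_
  ring

/-- The space of finitely supported functions on `X`, to be equipped with the semi-inner product
`[·, ·]_L` of the positive definite kernel `L`. -/
@[nolint unusedArguments]
def PreSpace {L : X → X → ℂ} (_ : IsPosDefKernel L) : Type _ := X →₀ ℂ

variable {L : X → X → ℂ} (hL : IsPosDefKernel L)

instance : AddCommGroup (PreSpace hL) := inferInstanceAs (AddCommGroup (X →₀ ℂ))
instance : Module ℂ (PreSpace hL) := inferInstanceAs (Module ℂ (X →₀ ℂ))

/-- The identity map, from finitely supported functions to the semi-inner product space. -/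
def toPre : (X →₀ ℂ) ≃ₗ[ℂ] PreSpace hL := LinearEquiv.refl ℂ _

/-- The semi-inner product `[·, ·]_L`. In Mathlib inner products are linear in the second variable,
so `⟪f, g⟫ = [g, f]_L`. -/
abbrev preCore : PreInnerProductSpace.Core ℂ (PreSpace hL) where
  inner f g := kernelForm L ((toPre hL).symm g) ((toPre hL).symm f)
  conj_inner_symm f g := kernelForm_conj hL.1 _ _
  re_inner_nonneg f := hL.2 _
  add_left f f' g := by rw [map_add]; exact kernelForm_add_right hL.1 _ _ _
  smul_left f g c := by rw [map_smul]; exact kernelForm_smul_right hL.1 _ _ _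

instance : SeminormedAddCommGroup (PreSpace hL) :=
  InnerProductSpace.Core.toSeminormedAddCommGroup (c := preCore hL)
instance : InnerProductSpace ℂ (PreSpace hL) :=
  InnerProductSpace.ofCore (preCore hL)

lemma preInner_def (f g : X →₀ ℂ) :
    ⟪toPre hL f, toPre hL g⟫_ℂ = kernelForm L g f := rfl

/-- The Hilbert space `H_L`: the Hausdorff completion of the finitely supported functions with
respect to `[·, ·]_L`, that is, the completion of their quotient by the isotropic subspace. -/
abbrev HilbertOf : Type _ := UniformSpace.Completion (PreSpace hL)

/-- The canonical map `f ↦ [f]` of the finitely supported functions into `H_L`. -/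
def toHilbert : (X →₀ ℂ) →ₗ[ℂ] HilbertOf hL :=
  (UniformSpace.Completion.toComplL (𝕜 := ℂ) (E := PreSpace hL)).toLinearMap ∘ₗ
    (toPre hL).toLinearMap

lemma inner_toHilbert (f g : X →₀ ℂ) :
    ⟪toHilbert hL f, toHilbert hL g⟫_ℂ = kernelForm L g f :=
  (UniformSpace.Completion.inner_coe _ _).trans (preInner_def hL f g)

lemma denseRange_toHilbert : DenseRange (toHilbert hL) :=
  UniformSpace.Completion.denseRange_coe (α := PreSpace hL)

lemma preNorm_sq (f : X →₀ ℂ) : ‖toPre hL f‖ ^ 2 = (kernelForm L f f).re := by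
  rw [@norm_sq_eq_re_inner ℂ, preInner_def]; rfl

variable {K : X → X → ℂ}

lemma posDef_add (hL : IsPosDefKernel L) (hle : KernelLE (-L) K) : IsPosDefKernel (L + K) := by
  refine ⟨fun x y => ?_, fun f => ?_⟩
  · simp only [Pi.add_apply, map_add, ← hL.1 x y, ← hle.2.1 x y]
  · have h := hle.2.2 f
    rw [kernelForm_kernel_neg, Complex.neg_re] at h
    rw [kernelForm_kernel_add, Complex.add_re]
    linarith

lemma posDef_sub (hL : IsPosDefKernel L) (hle : KernelLE K L) : IsPosDefKernel (L + -K) := by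
  refine ⟨fun x y => ?_, fun f => ?_⟩
  · simp only [Pi.add_apply, Pi.neg_apply, map_add, map_neg, ← hL.1 x y, ← hle.1 x y]
  · have h := hle.2.2 f
    rw [kernelForm_kernel_add, kernelForm_kernel_neg, Complex.add_re, Complex.neg_re]
    linarith

/-- The Schwarz type inequality `|[f, g]_K| ≤ [f, f]_L^{1/2} [g, g]_L^{1/2}`. -/
lemma norm_kernelForm_le (h₁ : KernelLE (-L) K) (h₂ : KernelLE K L) (f g : X →₀ ℂ) :
    ‖kernelForm K f g‖ ≤ ‖toPre hL g‖ * ‖toPre hL f‖ := by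
  have hp := posDef_add hL h₁
  have hm := posDef_sub hL h₂
  have e1 : kernelForm K f g =
      (1 / 2 : ℂ) * (kernelForm (L + K) f g - kernelForm (L + -K) f g) := by
    rw [kernelForm_kernel_add, kernelForm_kernel_add, kernelForm_kernel_neg]; ring
  have np : ‖kernelForm (L + K) f g‖ ≤ ‖toPre hp g‖ * ‖toPre hp f‖ := by
    rw [← preInner_def hp]; exact norm_inner_le_norm _ _
  have nm : ‖kernelForm (L + -K) f g‖ ≤ ‖toPre hm g‖ * ‖toPre hm f‖ := by
    rw [← preInner_def hm]; exact norm_inner_le_norm _ _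
  have sq : ∀ u : X →₀ ℂ, ‖toPre hp u‖ ^ 2 + ‖toPre hm u‖ ^ 2 = 2 * ‖toPre hL u‖ ^ 2 := by
    intro u
    rw [preNorm_sq, preNorm_sq, preNorm_sq, kernelForm_kernel_add, kernelForm_kernel_add,
      kernelForm_kernel_neg]
    simp only [Complex.add_re, Complex.neg_re]
    ring
  have n1 : ‖kernelForm K f g‖ ≤
      1 / 2 * (‖toPre hp g‖ * ‖toPre hp f‖ + ‖toPre hm g‖ * ‖toPre hm f‖) := by
    rw [e1, norm_mul]
    have h3 := norm_sub_le (kernelForm (L + K) f g) (kernelForm (L + -K) f g)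
    have h4 : ‖(1 / 2 : ℂ)‖ = 1 / 2 := by norm_num
    rw [h4]
    linarith
  refine n1.trans (abs_le_of_sq_le_sq' ?_ (by positivity)).2
  have sf := sq f
  have sg := sq g
  have key : (‖toPre hp g‖ * ‖toPre hp f‖ + ‖toPre hm g‖ * ‖toPre hm f‖) ^ 2 ≤
      (‖toPre hp g‖ ^ 2 + ‖toPre hm g‖ ^ 2) * (‖toPre hp f‖ ^ 2 + ‖toPre hm f‖ ^ 2) := by
    nlinarith [sq_nonneg (‖toPre hp g‖ * ‖toPre hm f‖ - ‖toPre hm g‖ * ‖toPre hp f‖)]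
  rw [sf, sg] at key
  nlinarith [key]

/-- The form `(f, g) ↦ [g, f]_K`, conjugate linear in `f` and linear in `g`, as a bounded form on
the semi-inner product space of `L`. -/
def preForm (h₁ : KernelLE (-L) K) (h₂ : KernelLE K L) :
    PreSpace hL →L⋆[ℂ] PreSpace hL →L[ℂ] ℂ :=
  LinearMap.mkContinuous₂
    (LinearMap.mk₂'ₛₗ (starRingEnd ℂ) (RingHom.id ℂ)
      (fun f g : PreSpace hL => kernelForm K ((toPre hL).symm g) ((toPre hL).symm f))
      (fun f f' g => by rw [map_add]; exact kernelForm_add_right h₂.1 _ _ _)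
      (fun c f g => by rw [map_smul]; exact kernelForm_smul_right h₂.1 _ _ _)
      (fun f g g' => by rw [map_add]; exact kernelForm_add_left _ _ _ _)
      (fun c f g => by rw [map_smul]; exact kernelForm_smul_left _ _ _ _))
    1 (fun f g => by
      rw [one_mul]
      exact norm_kernelForm_le hL h₁ h₂ ((toPre hL).symm g) ((toPre hL).symm f))

/-- The bounded sesquilinear form on `H_L` which extends `(f, g) ↦ [g, f]_K`. -/
def extendedForm (h₁ : KernelLE (-L) K) (h₂ : KernelLE K L) :
    HilbertOf hL →L⋆[ℂ] HilbertOf hL →L[ℂ] ℂ :=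
  extendForm (preForm hL h₁ h₂)

/-- The Gram operator `A_L` of `K` with respect to `L`, for `-L ≤ K ≤ L`: the bounded operator on
`H_L` which the Riesz representation theorem attaches to the extension of `[·, ·]_K`. -/
def gramOperator (h₁ : KernelLE (-L) K) (h₂ : KernelLE K L) : HilbertOf hL →L[ℂ] HilbertOf hL :=
  InnerProductSpace.continuousLinearMapOfBilin (extendedForm hL h₁ h₂)

/-- The defining property of the Gram operator: `[f, g]_K = [A_L f, g]_L`. -/
theorem inner_gramOperator (h₁ : KernelLE (-L) K) (h₂ : KernelLE K L) (f g : X →₀ ℂ) :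
    ⟪toHilbert hL g, gramOperator hL h₁ h₂ (toHilbert hL f)⟫_ℂ = kernelForm K f g := by
  rw [← inner_conj_symm, gramOperator, InnerProductSpace.continuousLinearMapOfBilin_apply,
    ← kernelForm_conj h₂.1]
  congr 1
  exact extendForm_coe (preForm hL h₁ h₂) (toPre hL f) (toPre hL g)

end Kernels

/-! ### Krein spaces -/

/-- A Krein space, given by a Hilbert space together with a fundamental symmetry `J`,
`J* = J = J⁻¹`. -/
class KreinSpace (K : Type*) [NormedAddCommGroup K] [InnerProductSpace ℂ K] [CompleteSpace K] where
  /-- the fundamental symmetry -/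
  J : K →L[ℂ] K
  selfAdjoint_J : IsSelfAdjoint J
  J_mul_J : J * J = 1

section Krein

variable {K₁ K₂ : Type*}
  [NormedAddCommGroup K₁] [InnerProductSpace ℂ K₁] [CompleteSpace K₁] [KreinSpace K₁]
  [NormedAddCommGroup K₂] [InnerProductSpace ℂ K₂] [CompleteSpace K₂] [KreinSpace K₂]

/-- The indefinite inner product `[x, y] = ⟨J x, y⟩` (linear in `x`, conjugate linear in `y`) of
a Krein space. -/
def kreinForm (x y : K₁) : ℂ := ⟪y, KreinSpace.J x⟫_ℂ

/-- The Krein space adjoint `T^♯ = J T* J`, the adjoint with respect to the indefinite inner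
products. -/
def kreinAdjoint (T : K₁ →L[ℂ] K₂) : K₂ →L[ℂ] K₁ :=
  (KreinSpace.J : K₁ →L[ℂ] K₁) ∘L (ContinuousLinearMap.adjoint T) ∘L (KreinSpace.J : K₂ →L[ℂ] K₂)

/-- Unitary operators between Krein spaces: `U U^♯ = 1` and `U^♯ U = 1`. -/
def IsKreinUnitary (U : K₁ →L[ℂ] K₂) : Prop :=
  U ∘L kreinAdjoint U = ContinuousLinearMap.id ℂ K₂ ∧
    kreinAdjoint U ∘L U = ContinuousLinearMap.id ℂ K₁

end Krein

/-! ### Non-commutative polynomials, GNS data and GNS functionals -/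

/-- The algebra of polynomials with complex coefficients in `N` non-commuting indeterminates, that
is, the algebra of finite sums `∑ c_σ Y_σ` over the words `σ` of the free semigroup with unit on
`N` generators, with `Y_σ Y_τ = Y_{στ}`. -/
abbrev NCPoly (N : ℕ) : Type := MonoidAlgebra ℂ (FreeMonoid (Fin N))

/-- The monomial `Y_σ`. -/
def monomial {N : ℕ} (σ : FreeMonoid (Fin N)) : NCPoly N := MonoidAlgebra.single σ 1

/-- The involution `(∑ c_σ Y_σ)* = ∑ conj(c_σ) Y_{I(σ)}`, where `I(σ) = star σ` is the word `σ`
read backwards. -/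
def involution {N : ℕ} (P : NCPoly N) : NCPoly N :=
  P.coeff.sum fun σ c => MonoidAlgebra.single (star σ) (conj c)

/-- Hermitian functionals: `Z(P*) = conj (Z(P))`. -/
def IsHermitianFunctional {N : ℕ} (Z : NCPoly N →ₗ[ℂ] ℂ) : Prop :=
  ∀ P, Z (involution P) = conj (Z P)

/-- A hermitian closable representation of the polynomials by (in general unbounded) operators
with a common dense invariant domain in the Krein space `K`. -/
structure HermitianRep (N : ℕ) (K : Type*) [NormedAddCommGroup K] [InnerProductSpace ℂ K]
    [CompleteSpace K] [KreinSpace K] where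
  /-- the domain of the representation -/
  domain : Submodule ℂ K
  dense_domain : Dense (domain : Set K)
  /-- the operators of the representation, on the invariant domain -/
  op : NCPoly N →ₐ[ℂ] Module.End ℂ domain
  hermitian : ∀ (P : NCPoly N) (x y : domain),
    kreinForm (op P x : K) (y : K) = kreinForm (x : K) (op (involution P) y : K)
  closable : ∀ P : NCPoly N,
    (LinearPMap.mk domain (domain.subtype ∘ₗ op P) : K →ₗ.[ℂ] K).IsClosable

/-- GNS data `(π, K, Ω)` associated to the functional `Z`: `Z(P) = [π(P) Ω, Ω]` for all `P`, and
the vectors `π(P) Ω` span the domain of `π`. -/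
structure GNSData {N : ℕ} (Z : NCPoly N →ₗ[ℂ] ℂ) (K : Type*) [NormedAddCommGroup K]
    [InnerProductSpace ℂ K] [CompleteSpace K] [KreinSpace K] extends HermitianRep N K where
  /-- the cyclic vector -/
  Ω : domain
  represents : ∀ P, Z P = kreinForm (op P Ω : K) (Ω : K)
  cyclic : Submodule.span ℂ (Set.range fun P => op P Ω) = ⊤

/-- GNS functionals: hermitian functionals which admit GNS data.  As the span of the countably many
vectors `π(Y_σ) Ω` is dense, the Krein space of GNS data is separable and has a copy in `Type`. -/
def IsGNSFunctional {N : ℕ} (Z : NCPoly N →ₗ[ℂ] ℂ) : Prop :=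
  IsHermitianFunctional Z ∧
    ∃ (K : Type) (_ : NormedAddCommGroup K) (_ : InnerProductSpace ℂ K) (_ : CompleteSpace K)
      (_ : KreinSpace K), Nonempty (GNSData Z K)

/-- Unitary equivalence of GNS data: a unitary operator of Krein spaces carries the cyclic vector to
the cyclic vector and the domain onto the domain, and intertwines the representations. -/
def GNSData.UnitarilyEquivalent {N : ℕ} {Z : NCPoly N →ₗ[ℂ] ℂ} {K₁ K₂ : Type*}
    [NormedAddCommGroup K₁] [InnerProductSpace ℂ K₁] [CompleteSpace K₁] [KreinSpace K₁]
    [NormedAddCommGroup K₂] [InnerProductSpace ℂ K₂] [CompleteSpace K₂] [KreinSpace K₂]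
    (D₁ : GNSData Z K₁) (D₂ : GNSData Z K₂) : Prop :=
  ∃ Φ : K₁ →L[ℂ] K₂, IsKreinUnitary Φ ∧ Φ (D₁.Ω : K₁) = (D₂.Ω : K₂) ∧
    D₁.domain.map Φ.toLinearMap = D₂.domain ∧
    ∀ (P : NCPoly N) (x : D₁.domain) (y : D₂.domain), Φ (x : K₁) = (y : K₂) →
      Φ (D₁.op P x : K₁) = (D₂.op P y : K₂)

/-- The GNS data of `Z` are unique up to unitary equivalence. -/
def UniqueGNSData {N : ℕ} (Z : NCPoly N →ₗ[ℂ] ℂ) : Prop :=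
  ∀ (K₁ K₂ : Type)
    [NormedAddCommGroup K₁] [InnerProductSpace ℂ K₁] [CompleteSpace K₁] [KreinSpace K₁]
    [NormedAddCommGroup K₂] [InnerProductSpace ℂ K₂] [CompleteSpace K₂] [KreinSpace K₂]
    (D₁ : GNSData Z K₁) (D₂ : GNSData Z K₂), D₁.UnitarilyEquivalent D₂

/-- The numbers `s_σ` are the moments of `Z`: `s_σ = Z(Y_σ)` for all words `σ`. -/
def HasMoments {N : ℕ} (Z : NCPoly N →ₗ[ℂ] ℂ) (s : FreeMonoid (Fin N) → ℂ) : Prop :=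
  ∀ σ, s σ = Z (monomial σ)

/-- The Hankel type kernel `K(σ, τ) = s_{I(σ) τ}`. -/
def hankelKernel {N : ℕ} (s : FreeMonoid (Fin N) → ℂ) :
    FreeMonoid (Fin N) → FreeMonoid (Fin N) → ℂ :=
  fun σ τ => s (star σ * τ)

end

end KreinMoment

open KreinMoment

open scoped InnerProductSpace ComplexConjugate

namespace KreinMoment

/-! ### Indefinite inner products and Kreĭn adjoints. -/

section KreinForm

variable {K₁ K₂ : Type*}
  [NormedAddCommGroup K₁] [InnerProductSpace ℂ K₁] [CompleteSpace K₁] [KreinSpace K₁]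
  [NormedAddCommGroup K₂] [InnerProductSpace ℂ K₂] [CompleteSpace K₂] [KreinSpace K₂]

/-! Functionals are determined by their moments, so only uniqueness of the GNS data is at stake.
Such data amount to a map `V` from finitely supported functions to a Kreĭn space, with dense range
and `[V f, V g] = [f, g]_K` (`IsKolmogorov`): `GNSData.vec` gives one direction,
`IsKolmogorov.gnsData` the other, and equivalence of data becomes a Kreĭn unitary `Φ` with `Φ V₁ =
V₂`. The question is thus when `V₁ f ↦ V₂ f` is bounded in both directions.

Gap implies uniqueness. Let `L` be the sum of the Gram kernels of `V₁` and `V₂`. Both maps extend to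
bounded operators `W` on `H_L` with `W* J W = A`, where `A` is the Gram operator. If `(0, ε)` misses
the spectrum of `A`, some bounded `B ≥ 0` inverts the positive part, so that `A B A = A₊`. The form
`2⟨B A h, A h⟩ - ⟨A h, h⟩ = ⟨|A| h, h⟩` is then comparable with `‖W h‖²` for every such `W`
(`exists_norm_equiv`), hence all these norms are equivalent. A gap on the left is handled by
changing the signs of `A` and `J`.

Uniqueness implies gap. Suppose that for some `L` the spectrum of `A` meets every `(0, ε)` and every
`(-ε, 0)`. Factor `A` by `V h = (A₊^{1/2} h, A₋^{1/2} h)` with `J = (1, -1)`. Pairing spectral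
vectors for small positive and small negative spectrum gives mutually orthogonal neutral vectors
`p_n`. The rotation multiplying `p_n` by `2^n` and `J p_n` by `2^{-n}` preserves the indefinite
form. The infinite product of these rotations is unbounded, but composed with `V` it converges in
norm, because the components of `V h` along `p_n` and `J p_n` are `O(4^{-n} ‖h‖)`. The limit is a
second dense factorization (`NeutralSystem.exists_stretched`), and no bounded operator carries `V`
to it. -/

lemma J_J (x : K₁) : KreinSpace.J (KreinSpace.J x : K₁) = x := by
  simpa using DFunLike.congr_fun (KreinSpace.J_mul_J (K := K₁)) x

lemma inner_J_left (x y : K₁) : ⟪KreinSpace.J x, y⟫_ℂ = ⟪x, KreinSpace.J y⟫_ℂ :=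
  (KreinSpace.selfAdjoint_J (K := K₁)).isSymmetric x y

lemma kreinForm_add_left (x y z : K₁) : kreinForm (x + y) z = kreinForm x z + kreinForm y z := by
  simp [kreinForm]

lemma kreinForm_add_right (x y z : K₁) : kreinForm x (y + z) = kreinForm x y + kreinForm x z := by
  simp [kreinForm]

lemma kreinForm_smul_left (c : ℂ) (x z : K₁) : kreinForm (c • x) z = c * kreinForm x z := by
  simp [kreinForm]

lemma kreinForm_smul_right (c : ℂ) (x z : K₁) : kreinForm x (c • z) = conj c * kreinForm x z :=
  inner_smul_left _ _ _

lemma kreinForm_continuous : Continuous fun p : K₁ × K₁ => kreinForm p.1 p.2 := by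
  unfold kreinForm; fun_prop

/-- The indefinite inner product of a Krein space is nondegenerate. -/
lemma eq_zero_of_kreinForm_dense {s : Set K₁} (hs : Dense s) {x : K₁}
    (h : ∀ y ∈ s, kreinForm x y = 0) : x = 0 := by
  have h0 : KreinSpace.J x = 0 := hs.eq_zero_of_inner_right ℂ fun y hy => h y hy
  rw [← J_J x, h0, map_zero]

lemma kreinAdjoint_kreinForm (T : K₁ →L[ℂ] K₂) (x : K₁) (y : K₂) :
    kreinForm (T x) y = kreinForm x (kreinAdjoint T y) := by
  simp only [kreinForm, kreinAdjoint, ContinuousLinearMap.comp_apply, inner_J_left, J_J,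
    ContinuousLinearMap.adjoint_inner_left]

end KreinForm

/-! ### Kolmogorov decompositions and their unitary equivalence. -/

section Kolmogorov

variable {X : Type*} {K₁ K₂ : Type*}
  [NormedAddCommGroup K₁] [InnerProductSpace ℂ K₁] [CompleteSpace K₁] [KreinSpace K₁]
  [NormedAddCommGroup K₂] [InnerProductSpace ℂ K₂] [CompleteSpace K₂] [KreinSpace K₂]

/-- Minimal Kolmogorov decompositions of a kernel in a Krein space. -/
structure IsKolmogorov (K : X → X → ℂ) (V : (X →₀ ℂ) →ₗ[ℂ] K₁) : Prop where
  denseRange : DenseRange V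
  form_eq : ∀ f g, kreinForm (V f) (V g) = kernelForm K f g

/-- Two decompositions with equivalent norms differ by a unitary operator of Krein spaces. -/
theorem IsKolmogorov.exists_unitary {K : X → X → ℂ} {V₁ : (X →₀ ℂ) →ₗ[ℂ] K₁}
    {V₂ : (X →₀ ℂ) →ₗ[ℂ] K₂} (h₁ : IsKolmogorov K V₁) (h₂ : IsKolmogorov K V₂)
    (h₁₂ : ∃ C, ∀ f, ‖V₂ f‖ ≤ C * ‖V₁ f‖) (h₂₁ : ∃ C, ∀ f, ‖V₁ f‖ ≤ C * ‖V₂ f‖) :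
    ∃ Φ : K₁ →L[ℂ] K₂, IsKreinUnitary Φ ∧ ∀ f, Φ (V₁ f) = V₂ f := by
  -- The two norm bounds make `V₁ f ↦ V₂ f` well defined and bicontinuous between dense ranges, so
  -- it extends to an isomorphism.
  set e := (LinearEquiv.refl ℂ (X →₀ ℂ)).extend V₁ V₂ h₁.denseRange h₁₂ h₂.denseRange h₂₁
  have e1 : ∀ f, e (V₁ f) = V₂ f := fun f =>
    (LinearEquiv.refl ℂ (X →₀ ℂ)).extend_eq V₁ V₂ h₁.denseRange h₁₂ h₂.denseRange h₂₁ f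
  have form : ∀ x y, kreinForm (e x) (e y) = kreinForm x y := by
    intro x y
    refine h₁.denseRange.induction_on₂ (p := fun x y => kreinForm (e x) (e y) = kreinForm x y)
      ?_ ?_ x y
    · refine isClosed_eq ?_ kreinForm_continuous
      exact kreinForm_continuous.comp (by fun_prop : Continuous fun p : K₁ × K₁ => (e p.1, e p.2))
    · intro f g
      rw [e1, e1, h₁.form_eq, h₂.form_eq]
  have left : ∀ y, kreinAdjoint (e : K₁ →L[ℂ] K₂) (e y) = y := by
    intro y
    rw [← sub_eq_zero]
    have hz : ∀ x, kreinForm x (kreinAdjoint (e : K₁ →L[ℂ] K₂) (e y) - y) = 0 := by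
      intro x
      rw [sub_eq_add_neg, ← neg_one_smul ℂ y, kreinForm_add_right, kreinForm_smul_right,
        ← kreinAdjoint_kreinForm, ← form x y]
      simp
    refine inner_self_eq_zero (𝕜 := ℂ).1 ?_
    -- Testing against `J v` turns the indefinite product with `v` into `⟪v, v⟫`.
    have := hz (KreinSpace.J (kreinAdjoint (e : K₁ →L[ℂ] K₂) (e y) - y))
    rwa [kreinForm, J_J] at this
  refine ⟨e, ⟨?_, ?_⟩, e1⟩
  · ext y
    obtain ⟨x, rfl⟩ := e.surjective y
    simpa using congrArg e (left x)
  · ext x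
    exact left x

end Kolmogorov

/-! ### The dictionary between GNS data and Kolmogorov decompositions of the Hankel kernel. -/

section GNS

variable {N : ℕ}

lemma involution_add (P Q : NCPoly N) : involution (P + Q) = involution P + involution Q := by
  unfold involution
  rw [MonoidAlgebra.coeff_add, Finsupp.sum_add_index'] <;> simp

lemma involution_single (σ : FreeMonoid (Fin N)) (c : ℂ) :
    involution (MonoidAlgebra.single σ c) = MonoidAlgebra.single (star σ) (conj c) := by
  unfold involution
  rw [MonoidAlgebra.coeff_single, Finsupp.sum_single_index]
  simp

lemma involution_zero : involution (0 : NCPoly N) = 0 := by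
  simp [involution]

lemma involution_mul (P Q : NCPoly N) : involution (P * Q) = involution Q * involution P := by
  induction P using MonoidAlgebra.induction_linear with
  | zero => simp [involution_zero]
  | add P P' hP hP' => rw [add_mul, involution_add, hP, hP', involution_add, mul_add]
  | single σ a =>
    induction Q using MonoidAlgebra.induction_linear with
    | zero => simp [involution_zero]
    | add Q Q' hQ hQ' => rw [mul_add, involution_add, hQ, hQ', involution_add, add_mul]
    | single τ b =>
      simp only [MonoidAlgebra.single_mul_single, involution_single, star_mul, map_mul, mul_comm]

lemma involution_involution (P : NCPoly N) : involution (involution P) = P := by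
  induction P using MonoidAlgebra.induction_linear with
  | zero => simp [involution_zero]
  | add P P' hP hP' => rw [involution_add, involution_add, hP, hP']
  | single σ a => simp [involution_single]

lemma involution_one : involution (1 : NCPoly N) = 1 := by
  rw [MonoidAlgebra.one_def, involution_single]
  simp

/-- Functionals are determined by their moments. -/
lemma HasMoments.unique {Z Z' : NCPoly N →ₗ[ℂ] ℂ} {s : FreeMonoid (Fin N) → ℂ}
    (h : HasMoments Z s) (h' : HasMoments Z' s) : Z = Z' := by
  refine MonoidAlgebra.lhom_ext' fun σ => ?_
  ext
  exact (h σ).symm.trans (h' σ)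

lemma HasMoments.apply_single {Z : NCPoly N →ₗ[ℂ] ℂ} {s : FreeMonoid (Fin N) → ℂ}
    (h : HasMoments Z s) (σ : FreeMonoid (Fin N)) (c : ℂ) :
    Z (MonoidAlgebra.single σ c) = c * s σ := by
  rw [h σ, monomial, ← smul_eq_mul c, ← map_smul, MonoidAlgebra.smul_single, smul_eq_mul, mul_one]

lemma HasMoments.isHermitianKernel {Z : NCPoly N →ₗ[ℂ] ℂ} {s : FreeMonoid (Fin N) → ℂ}
    (h : HasMoments Z s) (hZ : IsHermitianFunctional Z) : IsHermitianKernel (hankelKernel s) := by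
  intro σ τ
  have := hZ (monomial (star τ * σ))
  rw [monomial, involution_single, map_one, ← monomial, ← monomial, ← h, ← h, star_mul,
    star_star] at this
  exact this

/-- The form of the Hankel kernel in terms of the functional. -/
lemma HasMoments.kernelForm_eq {Z : NCPoly N →ₗ[ℂ] ℂ} {s : FreeMonoid (Fin N) → ℂ}
    (h : HasMoments Z s) (hZ : IsHermitianFunctional Z) (P Q : NCPoly N) :
    kernelForm (hankelKernel s) P.coeff Q.coeff = Z (involution Q * P) := by
  have hK := h.isHermitianKernel hZ
  induction P using MonoidAlgebra.induction_linear with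
  | zero => simp [kernelForm]
  | add P P' hP hP' => rw [mul_add, map_add, ← hP, ← hP', MonoidAlgebra.coeff_add,
      kernelForm_add_left]
  | single σ a =>
    induction Q using MonoidAlgebra.induction_linear with
    | zero => simp [kernelForm, involution_zero]
    | add Q Q' hQ hQ' => rw [involution_add, add_mul, map_add, ← hQ, ← hQ',
        MonoidAlgebra.coeff_add, kernelForm_add_right hK]
    | single τ b =>
      rw [involution_single, MonoidAlgebra.single_mul_single, h.apply_single, kernelForm,
        MonoidAlgebra.coeff_single, MonoidAlgebra.coeff_single, Finsupp.sum_single_index,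
        Finsupp.sum_single_index]
      · rw [hankelKernel]; ring
      · simp
      · simp

lemma exists_coeff_eq {E : Type*} [AddCommGroup E] [Module ℂ E]
    {V : (FreeMonoid (Fin N) →₀ ℂ) →ₗ[ℂ] E} (x : LinearMap.range V) :
    ∃ Q : NCPoly N, V Q.coeff = x := by
  obtain ⟨f, hf⟩ := x.2
  exact ⟨MonoidAlgebra.ofCoeff f, hf⟩

variable {𝒦 : Type*} [NormedAddCommGroup 𝒦] [InnerProductSpace ℂ 𝒦] [CompleteSpace 𝒦]
  [KreinSpace 𝒦] {Z : NCPoly N →ₗ[ℂ] ℂ}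

/-- The map `f ↦ π(∑ f(σ) Y_σ) Ω` of GNS data. -/
noncomputable def GNSData.vec (D : GNSData Z 𝒦) : (FreeMonoid (Fin N) →₀ ℂ) →ₗ[ℂ] 𝒦 :=
  D.domain.subtype ∘ₗ LinearMap.applyₗ D.Ω ∘ₗ D.op.toLinearMap ∘ₗ
    (MonoidAlgebra.coeffLinearEquiv ℂ (S := ℂ) (M := FreeMonoid (Fin N))).symm.toLinearMap

lemma GNSData.vec_coeff (D : GNSData Z 𝒦) (P : NCPoly N) :
    D.vec P.coeff = (D.op P D.Ω : 𝒦) := rfl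

lemma GNSData.exists_op_eq (D : GNSData Z 𝒦) (x : D.domain) : ∃ P, D.op P D.Ω = x := by
  have hx : x ∈ Submodule.span ℂ (Set.range fun P => D.op P D.Ω) := by
    rw [D.cyclic]; trivial
  have hle : Submodule.span ℂ (Set.range fun P => D.op P D.Ω) ≤
      LinearMap.range (LinearMap.applyₗ D.Ω ∘ₗ D.op.toLinearMap) := by
    rw [Submodule.span_le]
    rintro _ ⟨P, rfl⟩
    exact ⟨P, rfl⟩
  exact hle hx

lemma GNSData.range_vec (D : GNSData Z 𝒦) : LinearMap.range D.vec = D.domain := by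
  ext x
  constructor
  · rintro ⟨f, rfl⟩
    exact (D.op (MonoidAlgebra.ofCoeff f) D.Ω).2
  · intro hx
    obtain ⟨P, hP⟩ := D.exists_op_eq ⟨x, hx⟩
    exact ⟨P.coeff, by rw [D.vec_coeff, hP]⟩

/-- GNS data give a minimal Kolmogorov decomposition of the Hankel kernel. -/
theorem GNSData.isKolmogorov (D : GNSData Z 𝒦) {s : FreeMonoid (Fin N) → ℂ}
    (h : HasMoments Z s) (hZ : IsHermitianFunctional Z) :
    IsKolmogorov (hankelKernel s) D.vec where
  denseRange := by
    have := D.dense_domain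
    rw [← D.range_vec, LinearMap.coe_range] at this
    exact this
  form_eq f g := by
    obtain ⟨P, rfl⟩ : ∃ P : NCPoly N, P.coeff = f := ⟨MonoidAlgebra.ofCoeff f, rfl⟩
    obtain ⟨Q, rfl⟩ : ∃ Q : NCPoly N, Q.coeff = g := ⟨MonoidAlgebra.ofCoeff g, rfl⟩
    rw [h.kernelForm_eq hZ, D.represents, D.vec_coeff, D.vec_coeff, map_mul, Module.End.mul_apply,
      D.hermitian (involution Q), involution_involution]

section OfKolmogorov

variable {s : FreeMonoid (Fin N) → ℂ} {V : (FreeMonoid (Fin N) →₀ ℂ) →ₗ[ℂ] 𝒦}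

lemma IsKolmogorov.form_mul (hV : IsKolmogorov (hankelKernel s) V) (h : HasMoments Z s)
    (hZ : IsHermitianFunctional Z) (P Q R : NCPoly N) :
    kreinForm (V (P * Q).coeff) (V R.coeff) =
      kreinForm (V Q.coeff) (V (involution P * R).coeff) := by
  rw [hV.form_eq, hV.form_eq, h.kernelForm_eq hZ, h.kernelForm_eq hZ, involution_mul,
    involution_involution, mul_assoc]

/-- Left multiplication by `P` descends to the range of `V`: moving `P` to the other side as `P*`
shows that the products of `V (P Q)` with the dense range depend only on `V Q`, and the indefinite
form is nondegenerate. -/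
lemma IsKolmogorov.mul_congr (hV : IsKolmogorov (hankelKernel s) V) (h : HasMoments Z s)
    (hZ : IsHermitianFunctional Z) (P : NCPoly N) {Q Q' : NCPoly N}
    (hQ : V Q.coeff = V Q'.coeff) : V (P * Q).coeff = V (P * Q').coeff := by
  have key : V (P * Q).coeff - V (P * Q').coeff = 0 := by
    refine eq_zero_of_kreinForm_dense hV.denseRange ?_
    rintro _ ⟨f, rfl⟩
    obtain ⟨R, rfl⟩ : ∃ R : NCPoly N, R.coeff = f := ⟨MonoidAlgebra.ofCoeff f, rfl⟩
    rw [sub_eq_add_neg, ← neg_one_smul ℂ (V (P * Q').coeff), kreinForm_add_left,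
      kreinForm_smul_left, hV.form_mul h hZ, hV.form_mul h hZ, hQ]
    ring
  exact sub_eq_zero.1 key

/-- Multiplication by `P`, transported to the range of a Kolmogorov decomposition. -/
noncomputable def IsKolmogorov.mulFun (_ : IsKolmogorov (hankelKernel s) V) (P : NCPoly N)
    (x : LinearMap.range V) : LinearMap.range V :=
  ⟨V (P * (exists_coeff_eq x).choose).coeff, ⟨_, rfl⟩⟩

lemma IsKolmogorov.mulFun_eq (hV : IsKolmogorov (hankelKernel s) V) (h : HasMoments Z s)
    (hZ : IsHermitianFunctional Z) (P : NCPoly N) {x : LinearMap.range V} {Q : NCPoly N}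
    (hQ : V Q.coeff = x) : (hV.mulFun P x : 𝒦) = V (P * Q).coeff :=
  hV.mul_congr h hZ P ((exists_coeff_eq x).choose_spec.trans hQ.symm)

/-- The representation of the polynomials on the range of a Kolmogorov decomposition. -/
noncomputable def IsKolmogorov.op (hV : IsKolmogorov (hankelKernel s) V) (h : HasMoments Z s)
    (hZ : IsHermitianFunctional Z) : NCPoly N →ₐ[ℂ] Module.End ℂ (LinearMap.range V) :=
  AlgHom.ofLinearMap
    { toFun := fun P =>
        { toFun := hV.mulFun P
          map_add' := fun x y => by
            obtain ⟨Q, hQ⟩ := exists_coeff_eq x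
            obtain ⟨R, hR⟩ := exists_coeff_eq y
            refine Subtype.ext ?_
            have hQR : V (Q + R).coeff = ((x + y : LinearMap.range V) : 𝒦) := by
              rw [MonoidAlgebra.coeff_add, map_add, hQ, hR]; rfl
            rw [hV.mulFun_eq h hZ P hQR, Submodule.coe_add, hV.mulFun_eq h hZ P hQ,
              hV.mulFun_eq h hZ P hR, mul_add, MonoidAlgebra.coeff_add, map_add]
          map_smul' := fun c x => by
            obtain ⟨Q, hQ⟩ := exists_coeff_eq x
            refine Subtype.ext ?_
            have hcQ : V (c • Q).coeff = ((c • x : LinearMap.range V) : 𝒦) := by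
              rw [MonoidAlgebra.coeff_smul, map_smul, hQ]; rfl
            rw [hV.mulFun_eq h hZ P hcQ, RingHom.id_apply, Submodule.coe_smul,
              hV.mulFun_eq h hZ P hQ, mul_smul_comm, MonoidAlgebra.coeff_smul, map_smul] }
      map_add' := fun P P' => by
        refine LinearMap.ext fun x => Subtype.ext ?_
        obtain ⟨Q, hQ⟩ := exists_coeff_eq x
        change (hV.mulFun (P + P') x : 𝒦) = hV.mulFun P x + hV.mulFun P' x
        rw [hV.mulFun_eq h hZ _ hQ, hV.mulFun_eq h hZ _ hQ, hV.mulFun_eq h hZ _ hQ, add_mul,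
          MonoidAlgebra.coeff_add, map_add]
      map_smul' := fun c P => by
        refine LinearMap.ext fun x => Subtype.ext ?_
        obtain ⟨Q, hQ⟩ := exists_coeff_eq x
        change (hV.mulFun (c • P) x : 𝒦) = c • (hV.mulFun P x : 𝒦)
        rw [hV.mulFun_eq h hZ _ hQ, hV.mulFun_eq h hZ _ hQ, smul_mul_assoc,
          MonoidAlgebra.coeff_smul, map_smul] }
    (by
      refine LinearMap.ext fun x => Subtype.ext ?_
      obtain ⟨Q, hQ⟩ := exists_coeff_eq x
      change (hV.mulFun 1 x : 𝒦) = x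
      rw [hV.mulFun_eq h hZ _ hQ, one_mul, hQ])
    (fun P P' => by
      refine LinearMap.ext fun x => Subtype.ext ?_
      obtain ⟨Q, hQ⟩ := exists_coeff_eq x
      change (hV.mulFun (P * P') x : 𝒦) = hV.mulFun P (hV.mulFun P' x)
      have e := hV.mulFun_eq h hZ P' hQ
      rw [hV.mulFun_eq h hZ _ hQ, hV.mulFun_eq h hZ P e.symm, mul_assoc])

lemma IsKolmogorov.op_eq (hV : IsKolmogorov (hankelKernel s) V) (h : HasMoments Z s)
    (hZ : IsHermitianFunctional Z) (P : NCPoly N) {x : LinearMap.range V} {Q : NCPoly N}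
    (hQ : V Q.coeff = x) : (hV.op h hZ P x : 𝒦) = V (P * Q).coeff :=
  hV.mulFun_eq h hZ P hQ

/-- A densely defined operator with a densely defined adjoint, both with respect to the indefinite
inner product, is closable. -/
lemma isClosable_of_kreinForm {D : Submodule ℂ 𝒦} (hD : Dense (D : Set 𝒦)) {S T : Module.End ℂ D}
    (hST : ∀ x y : D, kreinForm (S x : 𝒦) (y : 𝒦) = kreinForm (x : 𝒦) (T y : 𝒦)) :
    (LinearPMap.mk D (D.subtype ∘ₗ S) : 𝒦 →ₗ.[ℂ] 𝒦).IsClosable := by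
  set A := (LinearPMap.mk D (D.subtype ∘ₗ S) : 𝒦 →ₗ.[ℂ] 𝒦)
  refine ⟨A.graph.topologicalClosure.toLinearPMap, ?_⟩
  rw [Submodule.toLinearPMap_graph_eq]
  intro p hp hp0
  refine eq_zero_of_kreinForm_dense hD fun y hy => ?_
  -- The adjoint relation with a fixed `y` in the domain is a closed condition on pairs, so it
  -- passes to the closure of the graph; a limit pair `(0, v)` then has `v` orthogonal to the dense
  -- domain.
  have cl : IsClosed {q : 𝒦 × 𝒦 | kreinForm q.2 y = kreinForm q.1 (T ⟨y, hy⟩ : 𝒦)} := by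
    unfold kreinForm
    exact isClosed_eq (by fun_prop) (by fun_prop)
  have hsub : (A.graph : Set (𝒦 × 𝒦)) ⊆
      {q : 𝒦 × 𝒦 | kreinForm q.2 y = kreinForm q.1 (T ⟨y, hy⟩ : 𝒦)} := by
    intro q hq
    obtain ⟨x, hx1, hx2⟩ := (LinearPMap.mem_graph_iff A).1 hq
    change kreinForm q.2 y = kreinForm q.1 (T ⟨y, hy⟩ : 𝒦)
    rw [← hx1, ← hx2]
    exact hST x ⟨y, hy⟩
  have hmem := closure_minimal hsub cl hp
  change kreinForm p.2 y = kreinForm p.1 (T ⟨y, hy⟩ : 𝒦) at hmem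
  rw [hmem, hp0]
  simp [kreinForm]

/-- A minimal Kolmogorov decomposition of the Hankel kernel gives GNS data. -/
noncomputable def IsKolmogorov.gnsData (hV : IsKolmogorov (hankelKernel s) V) (h : HasMoments Z s)
    (hZ : IsHermitianFunctional Z) : GNSData Z 𝒦 :=
  have dense : Dense (LinearMap.range V : Set 𝒦) := by
    rw [LinearMap.coe_range]; exact hV.denseRange
  have herm : ∀ (P : NCPoly N) (x y : LinearMap.range V),
      kreinForm (hV.op h hZ P x : 𝒦) (y : 𝒦) =
        kreinForm (x : 𝒦) (hV.op h hZ (involution P) y : 𝒦) := fun P x y => by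
    obtain ⟨Q, hQ⟩ := exists_coeff_eq x
    obtain ⟨R, hR⟩ := exists_coeff_eq y
    rw [hV.op_eq h hZ P hQ, hV.op_eq h hZ _ hR, ← hQ, ← hR, hV.form_mul h hZ]
  { domain := LinearMap.range V
    dense_domain := dense
    op := hV.op h hZ
    hermitian := herm
    closable := fun P => isClosable_of_kreinForm dense (herm P)
    Ω := ⟨V (1 : NCPoly N).coeff, ⟨_, rfl⟩⟩
    represents := fun P => by
      rw [hV.op_eq h hZ P rfl, hV.form_eq, h.kernelForm_eq hZ, involution_one, one_mul, mul_one]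
    cyclic := by
      rw [eq_top_iff]
      intro x _
      obtain ⟨Q, hQ⟩ := exists_coeff_eq x
      refine Submodule.subset_span ⟨Q, Subtype.ext ?_⟩
      change (hV.op h hZ Q _ : 𝒦) = x
      rw [hV.op_eq h hZ Q rfl, mul_one, hQ] }

lemma IsKolmogorov.vec_gnsData (hV : IsKolmogorov (hankelKernel s) V) (h : HasMoments Z s)
    (hZ : IsHermitianFunctional Z) (f : FreeMonoid (Fin N) →₀ ℂ) : (hV.gnsData h hZ).vec f = V f := by
  change (hV.op h hZ (MonoidAlgebra.ofCoeff f) ⟨V (1 : NCPoly N).coeff, ⟨_, rfl⟩⟩ : 𝒦) = V f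
  rw [hV.op_eq h hZ _ rfl, mul_one]

end OfKolmogorov

variable {𝒦' : Type*} [NormedAddCommGroup 𝒦'] [InnerProductSpace ℂ 𝒦'] [CompleteSpace 𝒦']
  [KreinSpace 𝒦']

/-- Unitary equivalence of GNS data in terms of the Kolmogorov decompositions. -/
theorem GNSData.unitarilyEquivalent_iff (D : GNSData Z 𝒦) (D' : GNSData Z 𝒦') :
    D.UnitarilyEquivalent D' ↔
      ∃ Φ : 𝒦 →L[ℂ] 𝒦', IsKreinUnitary Φ ∧ ∀ f, Φ (D.vec f) = D'.vec f := by
  refine exists_congr fun Φ => and_congr_right fun _ => ⟨?_, ?_⟩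
  · rintro ⟨hΩ, -, hop⟩ f
    exact hop (MonoidAlgebra.ofCoeff f) D.Ω D'.Ω hΩ
  · intro hΦ
    refine ⟨?_, ?_, ?_⟩
    · have := hΦ (1 : NCPoly N).coeff
      rwa [D.vec_coeff, D'.vec_coeff, map_one, map_one] at this
    · rw [← D.range_vec, ← D'.range_vec, ← LinearMap.range_comp]
      congr 1
      exact LinearMap.ext hΦ
    · intro P x y hxy
      -- By cyclicity `x = π(Q) Ω`, so the intertwining relation at `x` is the relation for `vec` at
      -- the polynomial `P Q`.
      obtain ⟨Q, rfl⟩ := D.exists_op_eq x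
      have hy : D'.op Q D'.Ω = y := Subtype.ext (by
        rw [← D'.vec_coeff, ← hΦ, D.vec_coeff, hxy])
      have := hΦ (P * Q).coeff
      rwa [D.vec_coeff, D'.vec_coeff, map_mul, map_mul, Module.End.mul_apply,
        Module.End.mul_apply, hy] at this

end GNS

/-! ### Spectral gaps and comparison of the norms of two factorizations. -/

section Operators

variable {H E : Type*} [NormedAddCommGroup H] [InnerProductSpace ℂ H] [CompleteSpace H]
  [NormedAddCommGroup E] [InnerProductSpace ℂ E] [CompleteSpace E]

/-- With `R` the square root of `T`, `‖R (R x)‖ ≤ ‖R‖ ‖R x‖`, while `‖R‖² = ‖T‖` and `‖R x‖² = ⟪T x,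
x⟫`. -/
lemma sq_norm_apply_le_of_nonneg {T : H →L[ℂ] H} (hT : 0 ≤ T) (x : H) :
    ‖T x‖ ^ 2 ≤ ‖T‖ * (⟪T x, x⟫_ℂ).re := by
  set R := CFC.sqrt T with hR
  have hRR : R * R = T := CFC.sqrt_mul_sqrt_self T hT
  have hRs : IsSelfAdjoint R := (CFC.sqrt_nonneg T).isSelfAdjoint
  have hn : ‖T‖ = ‖R‖ ^ 2 := by rw [← hRR, sq, hRs.norm_mul_self, sq]
  have e1 : T x = R (R x) := by rw [← hRR]; rfl
  have e2 : (⟪T x, x⟫_ℂ).re = ‖R x‖ ^ 2 := by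
    have h := hRs.isSymmetric (R x) x
    simp only [ContinuousLinearMap.coe_coe] at h
    rw [e1, h, @norm_sq_eq_re_inner ℂ]
    rfl
  rw [e2, hn, ← mul_pow, e1]
  exact pow_le_pow_left₀ (norm_nonneg _) (R.le_opNorm _) 2

/-- A continuous function equal to `1 / t` for `t ≥ ε` and to `0` for `t ≤ 0`. Its values on `(0,
ε)` are immaterial, since the spectrum will avoid that interval. -/
lemma exists_truncated_inverse {ε : ℝ} (hε : 0 < ε) :
    ∃ g : ℝ → ℝ, Continuous g ∧ (∀ t, 0 ≤ g t) ∧ (∀ t ≤ 0, g t = 0) ∧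
      ∀ t, ε ≤ t → t * g t * t = t := by
  have hpos : ∀ t, 0 < max t ε := fun t => lt_max_of_lt_right hε
  refine ⟨fun t => max t 0 / (max t ε) ^ 2, ?_, fun t => by positivity, fun t ht => ?_,
    fun t ht => ?_⟩
  · exact (by fun_prop : Continuous fun t : ℝ => max t 0).div (by fun_prop) fun t =>
      (pow_pos (hpos t) 2).ne'
  · simp [max_eq_right ht]
  · have h0 : 0 < t := hε.trans_le ht
    simp only [max_eq_left h0.le, max_eq_left ht]
    field_simp

/-- If `A` has a gap `(0, ε)` in its spectrum, then inverting `A` on its positive part is a bounded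
operation. -/
lemma exists_inverse_of_gap {A : H →L[ℂ] H} (hA : IsSelfAdjoint A) {ε : ℝ} (hε : 0 < ε)
    (hgap : ∀ t ∈ Set.Ioo 0 ε, t ∉ spectrum ℝ A) :
    ∃ B : H →L[ℂ] H, 0 ≤ B ∧ 0 ≤ A * B * A - A := by
  obtain ⟨g, hgc, hg0, hneg, hpos⟩ := exists_truncated_inverse hε
  have hgc' : ContinuousOn g (spectrum ℝ A) := hgc.continuousOn
  refine ⟨cfc g A, cfc_nonneg fun t _ => hg0 t, ?_⟩
  have e : A * cfc g A * A - A = cfc (fun t : ℝ => t * g t * t - t) A := by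
    rw [cfc_sub (fun t : ℝ => t * g t * t) (fun t => t) A,
      cfc_mul (fun t : ℝ => t * g t) (fun t => t) A, cfc_mul (fun t : ℝ => t) g A, cfc_id' ℝ A]
  rw [e]
  -- On the spectrum the function is `-t` for `t ≤ 0` and `0` for `t ≥ ε`: the operator is the
  -- negative part of `A`.
  refine cfc_nonneg fun t ht => ?_
  rcases le_or_gt t 0 with h0 | h0
  · rw [hneg t h0]
    linarith
  · have hεt : ε ≤ t := by
      by_contra! h
      exact hgap t ⟨h0, h⟩ ht
    rw [hpos t hεt, sub_self]

/-- For dense factorizations `A = W* J W` with a symmetry `J`, the norm `‖W h‖` is controlled from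
both sides by a quadratic form which depends only on `A`. -/
theorem exists_norm_equiv {A B : H →L[ℂ] H} (hB : 0 ≤ B) (hAB : 0 ≤ A * B * A - A)
    (hA : IsSelfAdjoint A) {J : E →L[ℂ] E} (hJ : IsSelfAdjoint J) (hJJ : J * J = 1)
    {W : H →L[ℂ] E} (hW : DenseRange W) (hWA : ∀ h k, ⟪W k, J (W h)⟫_ℂ = ⟪k, A h⟫_ℂ) :
    ∃ C C' : ℝ, 0 ≤ C ∧ 0 ≤ C' ∧ ∀ h,
      ‖W h‖ ^ 2 ≤ C * (2 * (⟪B (A h), A h⟫_ℂ).re - (⟪A h, h⟫_ℂ).re) ∧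
      2 * (⟪B (A h), A h⟫_ℂ).re - (⟪A h, h⟫_ℂ).re ≤ C' * ‖W h‖ ^ 2 := by
  have hJs : ∀ x y, ⟪J x, y⟫_ℂ = ⟪x, J y⟫_ℂ := hJ.isSymmetric
  have hAs : ∀ x y, ⟪A x, y⟫_ℂ = ⟪x, A y⟫_ℂ := hA.isSymmetric
  have hJJx : ∀ x, J (J x) = x := fun x => DFunLike.congr_fun hJJ x
  have hJn : ∀ x, ‖J x‖ = ‖x‖ := fun x => by
    rw [← sq_eq_sq₀ (norm_nonneg _) (norm_nonneg _), @norm_sq_eq_re_inner ℂ, hJs, hJJx,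
      ← @norm_sq_eq_re_inner ℂ]
  set Wd := ContinuousLinearMap.adjoint W with hWd
  have hWdA : ∀ h, Wd (J (W h)) = A h := fun h => ext_inner_left ℂ fun k => by
    rw [ContinuousLinearMap.adjoint_inner_right, hWA]
  have hb0 : ∀ h, 0 ≤ (⟪B (A h), A h⟫_ℂ).re := fun h =>
    ((ContinuousLinearMap.nonneg_iff_isPositive B).1 hB).re_inner_nonneg_left _
  have hba : ∀ h, 0 ≤ (⟪B (A h), A h⟫_ℂ).re - (⟪A h, h⟫_ℂ).re := fun h => by
    have := ((ContinuousLinearMap.nonneg_iff_isPositive _).1 hAB).re_inner_nonneg_left h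
    have e : ⟪(A * B * A - A) h, h⟫_ℂ = ⟪B (A h), A h⟫_ℂ - ⟪A h, h⟫_ℂ := by
      rw [← hAs, ← inner_sub_left]; rfl
    rw [e] at this
    exact this
  -- `S` transports `A B A - A` to the space `E`: its quadratic form at `W h` is that of `A B A - A`
  -- at `h`. Positivity of `S` therefore follows from density of the range of `W`.
  set S : E →L[ℂ] E := J ∘L W ∘L B ∘L Wd ∘L J - J with hS
  have hSW : ∀ h, S (W h) = J (W (B (A h))) - J (W h) := fun h => by
    rw [← hWdA]; rfl
  have hSf : ∀ h, (⟪S (W h), W h⟫_ℂ).re = (⟪B (A h), A h⟫_ℂ).re - (⟪A h, h⟫_ℂ).re := fun h => by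
    rw [hSW, inner_sub_left, hJs, hWA, hJs, hWA, hAs, Complex.sub_re]
  have hBs : IsSelfAdjoint B := hB.isSelfAdjoint
  have hSs : IsSelfAdjoint S := by
    refine IsSelfAdjoint.sub ?_ hJ
    rw [ContinuousLinearMap.isSelfAdjoint_iff_isSymmetric]
    intro x y
    have hBs' := hBs.isSymmetric (Wd (J x)) (Wd (J y))
    simp only [ContinuousLinearMap.coe_coe, ContinuousLinearMap.comp_apply] at hBs' ⊢
    rw [hJs, ← ContinuousLinearMap.adjoint_inner_right, hBs', ContinuousLinearMap.adjoint_inner_left,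
      hJs]
  have hS0 : 0 ≤ S := by
    rw [ContinuousLinearMap.nonneg_iff_isPositive, ContinuousLinearMap.isPositive_def']
    refine ⟨hSs, fun x => ?_⟩
    refine hW.induction_on (p := fun x => 0 ≤ S.reApplyInnerSelf x) x
      (isClosed_le continuous_const S.reApplyInnerSelf_continuous) fun h => ?_
    rw [ContinuousLinearMap.reApplyInnerSelf]
    exact (hba h).trans_eq (hSf h).symm
  -- Put `a = ⟪B (A h), A h⟫` and `d = a - ⟪A h, h⟫`, both nonnegative in real part; the form to
  -- compare with is `a + d`. The first constant comes from `‖W h‖² ≤ 2 ‖W‖² ‖B‖ a + 2 ‖S‖ d`.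
  refine ⟨2 * ‖S‖ + 2 * ‖W‖ ^ 2 * ‖B‖, 2 * (‖B‖ * ‖W‖ ^ 2) + 1, by positivity, by positivity,
    fun h => ⟨?_, ?_⟩⟩
  · have h1 : ‖S (W h)‖ ^ 2 ≤ ‖S‖ * ((⟪B (A h), A h⟫_ℂ).re - (⟪A h, h⟫_ℂ).re) := by
      rw [← hSf]; exact sq_norm_apply_le_of_nonneg hS0 _
    -- `J W h` splits as `J W B A h - S W h`; the first term is controlled by `a`, the second by
    -- `d`.
    have h2 : ‖B (A h)‖ ^ 2 ≤ ‖B‖ * (⟪B (A h), A h⟫_ℂ).re := sq_norm_apply_le_of_nonneg hB _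
    have h3 : ‖W h‖ ≤ ‖W (B (A h))‖ + ‖S (W h)‖ := by
      rw [← hJn (W h), ← hJn (W (B (A h)))]
      have : J (W h) = J (W (B (A h))) - S (W h) := by rw [hSW]; abel
      rw [this]
      exact norm_sub_le _ _
    have h4 : ‖W (B (A h))‖ ^ 2 ≤ ‖W‖ ^ 2 * (‖B‖ * (⟪B (A h), A h⟫_ℂ).re) := by
      refine (pow_le_pow_left₀ (norm_nonneg _) (W.le_opNorm _) 2).trans ?_
      rw [mul_pow]
      exact mul_le_mul_of_nonneg_left h2 (by positivity)
    have h5 : ‖W h‖ ^ 2 ≤ 2 * ‖W (B (A h))‖ ^ 2 + 2 * ‖S (W h)‖ ^ 2 := by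
      refine (pow_le_pow_left₀ (norm_nonneg _) h3 2).trans ?_
      nlinarith [sq_nonneg (‖W (B (A h))‖ - ‖S (W h)‖)]
    have h6 : 0 ≤ ‖S‖ * (⟪B (A h), A h⟫_ℂ).re := mul_nonneg (norm_nonneg _) (hb0 h)
    have h7 : 0 ≤ (‖W‖ ^ 2 * ‖B‖) * ((⟪B (A h), A h⟫_ℂ).re - (⟪A h, h⟫_ℂ).re) :=
      mul_nonneg (by positivity) (hba h)
    linarith
  · have h1 : (⟪B (A h), A h⟫_ℂ).re ≤ ‖B‖ * ‖W‖ ^ 2 * ‖W h‖ ^ 2 := by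
      -- `A h = W* J W h`, so `A h` is bounded by `W h` and not merely by `h`.
      have hAh : ‖A h‖ ≤ ‖W‖ * ‖W h‖ := by
        rw [← hWdA]
        refine (Wd.le_opNorm _).trans_eq ?_
        rw [hJn, hWd, LinearIsometryEquiv.norm_map]
      calc (⟪B (A h), A h⟫_ℂ).re ≤ ‖B (A h)‖ * ‖A h‖ := re_inner_le_norm (𝕜 := ℂ) _ _
        _ ≤ ‖B‖ * ‖A h‖ * ‖A h‖ := by gcongr; exact B.le_opNorm _
        _ = ‖B‖ * ‖A h‖ ^ 2 := by ring
        _ ≤ ‖B‖ * (‖W‖ * ‖W h‖) ^ 2 := by gcongr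
        _ = _ := by ring
    have h2 : -(⟪A h, h⟫_ℂ).re ≤ ‖W h‖ ^ 2 := by
      have e : (⟪A h, h⟫_ℂ).re = (⟪W h, J (W h)⟫_ℂ).re := by rw [hWA, hAs]
      have := Complex.abs_re_le_norm (⟪W h, J (W h)⟫_ℂ)
      have h3 := norm_inner_le_norm (𝕜 := ℂ) (W h) (J (W h))
      rw [hJn] at h3
      rw [e]
      linarith [neg_abs_le (⟪W h, J (W h)⟫_ℂ).re]
    linarith

/-- Two dense factorizations of a selfadjoint operator with a one-sided spectral gap at `0` have
comparable norms. -/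
theorem norm_le_of_gap {A : H →L[ℂ] H} (hA : IsSelfAdjoint A) {ε : ℝ} (hε : 0 < ε)
    (hgap : ∀ t ∈ Set.Ioo 0 ε, t ∉ spectrum ℝ A) {E' : Type*} [NormedAddCommGroup E']
    [InnerProductSpace ℂ E'] [CompleteSpace E'] {J : E →L[ℂ] E} (hJ : IsSelfAdjoint J)
    (hJJ : J * J = 1) {J' : E' →L[ℂ] E'} (hJ' : IsSelfAdjoint J') (hJJ' : J' * J' = 1)
    {W : H →L[ℂ] E} (hW : DenseRange W) (hWA : ∀ h k, ⟪W k, J (W h)⟫_ℂ = ⟪k, A h⟫_ℂ)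
    {W' : H →L[ℂ] E'} (hW' : DenseRange W') (hWA' : ∀ h k, ⟪W' k, J' (W' h)⟫_ℂ = ⟪k, A h⟫_ℂ) :
    ∃ C, ∀ h, ‖W' h‖ ≤ C * ‖W h‖ := by
  obtain ⟨B, hB, hAB⟩ := exists_inverse_of_gap hA hε hgap
  obtain ⟨_, C₁, _, h₁, hC₁⟩ := exists_norm_equiv hB hAB hA hJ hJJ hW hWA
  obtain ⟨C₂, _, h₂, _, hC₂⟩ := exists_norm_equiv hB hAB hA hJ' hJJ' hW' hWA'
  refine ⟨√(C₂ * C₁), fun h => ?_⟩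
  refine abs_le_of_sq_le_sq' ?_ (by positivity) |>.2
  rw [mul_pow, Real.sq_sqrt (by positivity), mul_assoc]
  exact (hC₂ h).1.trans (mul_le_mul_of_nonneg_left (hC₁ h).2 h₂)

end Operators

/-! ### Gram kernels, extension to `H_L`, and uniqueness from a one-sided gap. -/

section Kernels

variable {X : Type*}

/-- The Gram kernel of a linear map into an inner product space. -/
noncomputable def gramKernel {E : Type*} [NormedAddCommGroup E] [InnerProductSpace ℂ E]
    (V : (X →₀ ℂ) →ₗ[ℂ] E) : X → X → ℂ :=
  fun x y => ⟪V (Finsupp.single x 1), V (Finsupp.single y 1)⟫_ℂ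

lemma kernelForm_gramKernel {E : Type*} [NormedAddCommGroup E] [InnerProductSpace ℂ E]
    (V : (X →₀ ℂ) →ₗ[ℂ] E) (f g : X →₀ ℂ) : kernelForm (gramKernel V) f g = ⟪V g, V f⟫_ℂ := by
  have hV : ∀ f, V f = f.sum fun x a => a • V (Finsupp.single x 1) := fun f => by
    conv_lhs => rw [← Finsupp.sum_single f, map_finsuppSum]
    refine Finsupp.sum_congr fun x _ => ?_
    rw [← map_smul, Finsupp.smul_single_one]
  rw [hV f, hV g, kernelForm]
  simp only [Finsupp.sum, inner_sum, sum_inner, inner_smul_left, inner_smul_right, gramKernel]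
  refine Finset.sum_congr rfl fun x _ => ?_
  rw [Finset.mul_sum]
  refine Finset.sum_congr rfl fun y _ => ?_
  ring

lemma isHermitianKernel_gramKernel {E : Type*} [NormedAddCommGroup E] [InnerProductSpace ℂ E]
    (V : (X →₀ ℂ) →ₗ[ℂ] E) : IsHermitianKernel (gramKernel V) :=
  fun _ _ => (inner_conj_symm _ _).symm

lemma re_kernelForm_gramKernel {E : Type*} [NormedAddCommGroup E] [InnerProductSpace ℂ E]
    (V : (X →₀ ℂ) →ₗ[ℂ] E) (f : X →₀ ℂ) : (kernelForm (gramKernel V) f f).re = ‖V f‖ ^ 2 := by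
  rw [kernelForm_gramKernel, @norm_sq_eq_re_inner ℂ]; rfl

variable {K L : X → X → ℂ}

lemma norm_sq_toHilbert (hL : IsPosDefKernel L) (f : X →₀ ℂ) :
    ‖toHilbert hL f‖ ^ 2 = (kernelForm L f f).re := by
  rw [@norm_sq_eq_re_inner ℂ, inner_toHilbert]; rfl

lemma isSelfAdjoint_gramOperator (hL : IsPosDefKernel L) (h₁ : KernelLE (-L) K)
    (h₂ : KernelLE K L) : IsSelfAdjoint (gramOperator hL h₁ h₂) := by
  rw [ContinuousLinearMap.isSelfAdjoint_iff_isSymmetric]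
  intro x y
  refine (denseRange_toHilbert hL).induction_on₂
    (p := fun x y => ⟪gramOperator hL h₁ h₂ x, y⟫_ℂ = ⟪x, gramOperator hL h₁ h₂ y⟫_ℂ)
    (isClosed_eq (by fun_prop) (by fun_prop)) (fun f g => ?_) x y
  rw [← inner_conj_symm, inner_gramOperator, inner_gramOperator, kernelForm_conj h₂.1]

lemma notMem_spectrum_of_image_subset {A : Type*} [Ring A] [Algebra ℂ A] {a : A} {S : Set ℝ}
    (h : (fun t : ℝ => (t : ℂ)) '' S ⊆ resolventSet ℂ a) : ∀ t ∈ S, t ∉ spectrum ℝ a := by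
  intro t ht hmem
  rw [← spectrum.algebraMap_mem_iff ℂ] at hmem
  exact hmem (h ⟨t, ht, rfl⟩)

variable {K₁ K₂ : Type*}
  [NormedAddCommGroup K₁] [InnerProductSpace ℂ K₁] [CompleteSpace K₁] [KreinSpace K₁]
  [NormedAddCommGroup K₂] [InnerProductSpace ℂ K₂] [CompleteSpace K₂] [KreinSpace K₂]

lemma norm_J (x : K₁) : ‖(KreinSpace.J x : K₁)‖ = ‖x‖ := by
  rw [← sq_eq_sq₀ (norm_nonneg _) (norm_nonneg _), @norm_sq_eq_re_inner ℂ, inner_J_left, J_J,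
    ← @norm_sq_eq_re_inner ℂ]

/-- Since `J` is isometric, Cauchy–Schwarz applies; it follows that the Gram kernel of `V` dominates
both `K` and `-K`. -/
lemma IsKolmogorov.abs_re_kernelForm_le {V : (X →₀ ℂ) →ₗ[ℂ] K₁} (hV : IsKolmogorov K V)
    (f : X →₀ ℂ) : |(kernelForm K f f).re| ≤ ‖V f‖ ^ 2 := by
  rw [← hV.form_eq]
  refine (Complex.abs_re_le_norm _).trans ((norm_inner_le_norm (𝕜 := ℂ) _ _).trans_eq ?_)
  rw [norm_J, sq]

/-- A Kolmogorov decomposition which is bounded with respect to `L` extends to `H_L` and factors the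
Gram operator. -/
lemma IsKolmogorov.exists_extension {V : (X →₀ ℂ) →ₗ[ℂ] K₁} (hV : IsKolmogorov K V)
    (hL : IsPosDefKernel L) (h₁ : KernelLE (-L) K) (h₂ : KernelLE K L)
    (hVL : ∀ f, ‖V f‖ ^ 2 ≤ (kernelForm L f f).re) :
    ∃ W : HilbertOf hL →L[ℂ] K₁, (∀ f, W (toHilbert hL f) = V f) ∧ DenseRange W ∧
      ∀ h k, ⟪W k, KreinSpace.J (W h)⟫_ℂ = ⟪k, gramOperator hL h₁ h₂ h⟫_ℂ := by
  have hb : ∀ f, ‖V f‖ ≤ 1 * ‖toHilbert hL f‖ := fun f => by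
    rw [one_mul, ← sq_le_sq₀ (norm_nonneg _) (norm_nonneg _), norm_sq_toHilbert]
    exact hVL f
  have hW := LinearMap.extendOfNorm_eq (f := V) (denseRange_toHilbert hL) ⟨1, hb⟩
  refine ⟨V.extendOfNorm (toHilbert hL), hW, ?_, fun h k => ?_⟩
  · refine hV.denseRange.mono ?_
    rintro _ ⟨f, rfl⟩
    exact ⟨_, hW f⟩
  · refine (denseRange_toHilbert hL).induction_on₂
      (p := fun h k => ⟪V.extendOfNorm (toHilbert hL) k,
        KreinSpace.J (V.extendOfNorm (toHilbert hL) h)⟫_ℂ = ⟪k, gramOperator hL h₁ h₂ h⟫_ℂ)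
      (isClosed_eq (by fun_prop) (by fun_prop)) (fun f g => ?_) h k
    rw [hW, hW, inner_gramOperator]
    exact hV.form_eq f g

/-- If every Gram operator has a one-sided spectral gap at `0`, then all minimal Kolmogorov
decompositions are unitarily equivalent. -/
theorem IsKolmogorov.exists_unitary_of_gap (hK : IsHermitianKernel K)
    (hgap : ∀ (L : X → X → ℂ) (hL : IsPosDefKernel L) (h₁ : KernelLE (-L) K) (h₂ : KernelLE K L),
      ∃ ε : ℝ, 0 < ε ∧
        ((fun t : ℝ => (t : ℂ)) '' Set.Ioo 0 ε ⊆ resolventSet ℂ (gramOperator hL h₁ h₂) ∨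
          (fun t : ℝ => (t : ℂ)) '' Set.Ioo (-ε) 0 ⊆ resolventSet ℂ (gramOperator hL h₁ h₂)))
    {V₁ : (X →₀ ℂ) →ₗ[ℂ] K₁} (hV₁ : IsKolmogorov K V₁) {V₂ : (X →₀ ℂ) →ₗ[ℂ] K₂}
    (hV₂ : IsKolmogorov K V₂) :
    ∃ Φ : K₁ →L[ℂ] K₂, IsKreinUnitary Φ ∧ ∀ f, Φ (V₁ f) = V₂ f := by
  -- One summand already dominates `±K`; the sum also makes both `V₁` and `V₂` bounded on the same
  -- space `H_L`.
  set L : X → X → ℂ := gramKernel V₁ + gramKernel V₂ with hLdef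
  have hLf : ∀ f, (kernelForm L f f).re = ‖V₁ f‖ ^ 2 + ‖V₂ f‖ ^ 2 := fun f => by
    rw [hLdef, kernelForm_kernel_add, Complex.add_re, re_kernelForm_gramKernel,
      re_kernelForm_gramKernel]
  have hLh : IsHermitianKernel L := fun x y => by
    rw [hLdef, Pi.add_apply, Pi.add_apply, Pi.add_apply, Pi.add_apply, map_add,
      ← isHermitianKernel_gramKernel V₁ x y, ← isHermitianKernel_gramKernel V₂ x y]
  have hL : IsPosDefKernel L := ⟨hLh, fun f => by rw [hLf]; positivity⟩
  have h₁ : KernelLE (-L) K := by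
    refine ⟨fun x y => ?_, hK, fun f => ?_⟩
    · simp only [Pi.neg_apply, map_neg, ← hLh x y]
    · rw [kernelForm_kernel_neg, Complex.neg_re, hLf]
      linarith [neg_le_of_abs_le (hV₁.abs_re_kernelForm_le f), sq_nonneg ‖V₂ f‖]
  have h₂ : KernelLE K L := by
    refine ⟨hK, hLh, fun f => ?_⟩
    rw [hLf]
    linarith [le_of_abs_le (hV₁.abs_re_kernelForm_le f), sq_nonneg ‖V₂ f‖]
  obtain ⟨W₁, e₁, d₁, f₁⟩ := hV₁.exists_extension hL h₁ h₂ fun f => by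
    rw [hLf]; linarith [sq_nonneg ‖V₂ f‖]
  obtain ⟨W₂, e₂, d₂, f₂⟩ := hV₂.exists_extension hL h₁ h₂ fun f => by
    rw [hLf]; linarith [sq_nonneg ‖V₁ f‖]
  have hA := isSelfAdjoint_gramOperator hL h₁ h₂
  have j₁ := KreinSpace.selfAdjoint_J (K := K₁)
  have j₂ := KreinSpace.selfAdjoint_J (K := K₂)
  have jj₁ := KreinSpace.J_mul_J (K := K₁)
  have jj₂ := KreinSpace.J_mul_J (K := K₂)
  have key : (∃ C, ∀ h, ‖W₂ h‖ ≤ C * ‖W₁ h‖) ∧ ∃ C, ∀ h, ‖W₁ h‖ ≤ C * ‖W₂ h‖ := by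
    obtain ⟨ε, hε, hg | hg⟩ := hgap L hL h₁ h₂
    · have hg' := notMem_spectrum_of_image_subset hg
      exact ⟨norm_le_of_gap hA hε hg' j₁ jj₁ j₂ jj₂ d₁ f₁ d₂ f₂,
        norm_le_of_gap hA hε hg' j₂ jj₂ j₁ jj₁ d₂ f₂ d₁ f₁⟩
    -- A gap on the left of `0` for `A` is a gap on the right for `-A`, which factors through the
    -- same maps with `-J` in place of `J`.
    · have hg' : ∀ t ∈ Set.Ioo 0 ε, t ∉ spectrum ℝ (-gramOperator hL h₁ h₂) := by
        intro t ht hmem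
        rw [← spectrum.neg_eq, Set.mem_neg] at hmem
        exact notMem_spectrum_of_image_subset hg (-t) ⟨by linarith [ht.2], by linarith [ht.1]⟩ hmem
      have f₁' : ∀ h k, ⟪W₁ k, (-KreinSpace.J : K₁ →L[ℂ] K₁) (W₁ h)⟫_ℂ =
          ⟪k, (-gramOperator hL h₁ h₂) h⟫_ℂ := fun h k => by
        rw [_root_.neg_apply, _root_.neg_apply, inner_neg_right,
          inner_neg_right, f₁]
      have f₂' : ∀ h k, ⟪W₂ k, (-KreinSpace.J : K₂ →L[ℂ] K₂) (W₂ h)⟫_ℂ =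
          ⟪k, (-gramOperator hL h₁ h₂) h⟫_ℂ := fun h k => by
        rw [_root_.neg_apply, _root_.neg_apply, inner_neg_right,
          inner_neg_right, f₂]
      have jj₁' := (neg_mul_neg (KreinSpace.J : K₁ →L[ℂ] K₁) KreinSpace.J).trans jj₁
      have jj₂' := (neg_mul_neg (KreinSpace.J : K₂ →L[ℂ] K₂) KreinSpace.J).trans jj₂
      exact ⟨norm_le_of_gap hA.neg hε hg' j₁.neg jj₁' j₂.neg jj₂' d₁ f₁' d₂ f₂',
        norm_le_of_gap hA.neg hε hg' j₂.neg jj₂' j₁.neg jj₁' d₂ f₂' d₁ f₁'⟩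
  obtain ⟨⟨C, hC⟩, C', hC'⟩ := key
  exact hV₁.exists_unitary hV₂ ⟨C, fun f => by rw [← e₁, ← e₂]; exact hC _⟩
    ⟨C', fun f => by rw [← e₁, ← e₂]; exact hC' _⟩

end Kernels

/-! ### Infinite products of hyperbolic rotations. -/

section Hyperbolic

open Filter Topology

variable {𝒦 : Type*} [NormedAddCommGroup 𝒦] [InnerProductSpace ℂ 𝒦] [CompleteSpace 𝒦]
  [KreinSpace 𝒦]

/-- The hyperbolic rotation with eigenvalue `r` on the neutral vector `p` and eigenvalue `r⁻¹` on
the neutral vector `J p`. -/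
noncomputable def hyperbolicRotation (p : 𝒦) (r : ℂ) : 𝒦 →L[ℂ] 𝒦 :=
  ContinuousLinearMap.id ℂ 𝒦 + ((r - 1) / 2) • InnerProductSpace.rankOne ℂ p p +
    ((r⁻¹ - 1) / 2) • InnerProductSpace.rankOne ℂ (KreinSpace.J p) (KreinSpace.J p)

lemma hyperbolicRotation_apply (p : 𝒦) (r : ℂ) (x : 𝒦) :
    hyperbolicRotation p r x = x + ((r - 1) / 2 * ⟪p, x⟫_ℂ) • p +
      ((r⁻¹ - 1) / 2 * ⟪KreinSpace.J p, x⟫_ℂ) • KreinSpace.J p := by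
  simp only [mul_smul]
  rfl

lemma inner_hyperbolicRotation_of_orthogonal {p y : 𝒦} (r : ℂ) (h : ⟪y, p⟫_ℂ = 0)
    (h' : ⟪y, KreinSpace.J p⟫_ℂ = 0) (x : 𝒦) : ⟪y, hyperbolicRotation p r x⟫_ℂ = ⟪y, x⟫_ℂ := by
  rw [hyperbolicRotation_apply, inner_add_right, inner_add_right, inner_smul_right,
    inner_smul_right, h, h']
  ring

lemma hyperbolicRotation_of_orthogonal {p x : 𝒦} (r : ℂ) (h : ⟪p, x⟫_ℂ = 0)
    (h' : ⟪KreinSpace.J p, x⟫_ℂ = 0) : hyperbolicRotation p r x = x := by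
  rw [hyperbolicRotation_apply, h, h']
  simp

lemma hyperbolicRotation_self {p : 𝒦} (r : ℂ) (hp : ⟪p, p⟫_ℂ = 2)
    (hpJ : ⟪p, KreinSpace.J p⟫_ℂ = 0) : hyperbolicRotation p r p = r • p := by
  rw [hyperbolicRotation_apply, inner_J_left, hp, hpJ]
  module

lemma hyperbolicRotation_J {p : 𝒦} (r : ℂ) (hp : ⟪p, p⟫_ℂ = 2)
    (hpJ : ⟪p, KreinSpace.J p⟫_ℂ = 0) :
    hyperbolicRotation p r (KreinSpace.J p) = r⁻¹ • KreinSpace.J p := by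
  rw [hyperbolicRotation_apply, inner_J_left, J_J, hp, hpJ]
  module

/-- Hyperbolic rotations preserve the indefinite inner product. -/
lemma kreinForm_hyperbolicRotation {p : 𝒦} {r : ℝ} (hr : r ≠ 0) (hp : ⟪p, p⟫_ℂ = 2)
    (hpJ : ⟪p, KreinSpace.J p⟫_ℂ = 0) (x y : 𝒦) :
    kreinForm (hyperbolicRotation p (r : ℂ) x) (hyperbolicRotation p (r : ℂ) y) =
      kreinForm x y := by
  have hpJ' : ⟪KreinSpace.J p, p⟫_ℂ = 0 := by rw [inner_J_left, hpJ]
  have hr' : (r : ℂ) ≠ 0 := by exact_mod_cast hr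
  -- Both `p` and `J p` are neutral, so only their mutual products survive, and these are multiplied
  -- by `r · r⁻¹ = 1`, as `r` is real.
  simp only [kreinForm, hyperbolicRotation_apply, map_add, map_smul, J_J, inner_add_left,
    inner_add_right, inner_smul_left, inner_smul_right, inner_J_left, hp, hpJ, map_mul, map_div₀,
    map_sub, map_one, Complex.conj_ofReal, map_inv₀, inner_conj_symm, map_ofNat]
  field_simp
  ring

/-- A sequence of pairwise orthogonal neutral vectors `p n` in the range of `V`, on which the
components of `V` decay geometrically. -/
structure NeutralSystem {H : Type*} [NormedAddCommGroup H] [InnerProductSpace ℂ H]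
    (V : H →L[ℂ] 𝒦) where
  /-- preimages of the neutral vectors -/
  a : ℕ → H
  /-- preimages of the images of the neutral vectors under the fundamental symmetry -/
  b : ℕ → H
  map_b : ∀ n, V (b n) = KreinSpace.J (V (a n))
  inner_self : ∀ n, ⟪V (a n), V (a n)⟫_ℂ = 2
  inner_J_self : ∀ n, ⟪V (a n), KreinSpace.J (V (a n))⟫_ℂ = 0
  inner_ne : ∀ m n, m ≠ n → ⟪V (a m), V (a n)⟫_ℂ = 0
  inner_J_ne : ∀ m n, m ≠ n → ⟪V (a m), KreinSpace.J (V (a n))⟫_ℂ = 0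
  /-- the constant in the decay -/
  C : ℝ
  C_nonneg : 0 ≤ C
  decay : ∀ n h, ‖⟪V (a n), V h⟫_ℂ‖ ≤ C * (1 / 4) ^ n * ‖h‖
  decay_J : ∀ n h, ‖⟪KreinSpace.J (V (a n)), V h⟫_ℂ‖ ≤ C * (1 / 4) ^ n * ‖h‖

namespace NeutralSystem

variable {H : Type*} [NormedAddCommGroup H] [InnerProductSpace ℂ H] {V : H →L[ℂ] 𝒦}
  (S : NeutralSystem V)

/-- The successive hyperbolic rotations of `V`. -/
noncomputable def approx : ℕ → H →L[ℂ] 𝒦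
  | 0 => V
  | n + 1 => hyperbolicRotation (V (S.a n)) ((2 ^ n : ℝ) : ℂ) ∘L approx n

lemma approx_succ_apply (n : ℕ) (h : H) :
    S.approx (n + 1) h = hyperbolicRotation (V (S.a n)) ((2 ^ n : ℝ) : ℂ) (S.approx n h) := rfl

lemma inner_J_J_ne {m n : ℕ} (hmn : m ≠ n) :
    ⟪KreinSpace.J (V (S.a m)), KreinSpace.J (V (S.a n))⟫_ℂ = 0 := by
  rw [inner_J_left, J_J, S.inner_ne m n hmn]

lemma inner_J_ne' {m n : ℕ} (hmn : m ≠ n) : ⟪KreinSpace.J (V (S.a m)), V (S.a n)⟫_ℂ = 0 := by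
  rw [inner_J_left, S.inner_J_ne m n hmn]

lemma kreinForm_approx (n : ℕ) (h k : H) :
    kreinForm (S.approx n h) (S.approx n k) = kreinForm (V h) (V k) := by
  induction n with
  | zero => rfl
  | succ n ih =>
    rw [approx_succ_apply, approx_succ_apply, kreinForm_hyperbolicRotation (by positivity)
      (S.inner_self n) (S.inner_J_self n), ih]

/-- Each rotation changes a vector only by multiples of its own `p_m` and `J p_m`. Used for the
vectors `p_n` and `J p_n`, which the earlier rotations do not see, and for the density of the limit.
-/
lemma inner_approx_of_orthogonal {y : 𝒦} (n : ℕ) (hy : ∀ m < n, ⟪y, V (S.a m)⟫_ℂ = 0)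
    (hy' : ∀ m < n, ⟪y, KreinSpace.J (V (S.a m))⟫_ℂ = 0) (h : H) :
    ⟪y, S.approx n h⟫_ℂ = ⟪y, V h⟫_ℂ := by
  induction n with
  | zero => rfl
  | succ n ih =>
    rw [approx_succ_apply, inner_hyperbolicRotation_of_orthogonal _ (hy n n.lt_succ_self)
      (hy' n n.lt_succ_self), ih (fun m hm => hy m (hm.trans n.lt_succ_self))
      (fun m hm => hy' m (hm.trans n.lt_succ_self))]

lemma inner_approx (n : ℕ) (h : H) : ⟪V (S.a n), S.approx n h⟫_ℂ = ⟪V (S.a n), V h⟫_ℂ :=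
  S.inner_approx_of_orthogonal n (fun _ hm => S.inner_ne _ _ hm.ne')
    (fun _ hm => S.inner_J_ne _ _ hm.ne') h

lemma inner_J_approx (n : ℕ) (h : H) :
    ⟪KreinSpace.J (V (S.a n)), S.approx n h⟫_ℂ = ⟪KreinSpace.J (V (S.a n)), V h⟫_ℂ :=
  S.inner_approx_of_orthogonal n (fun _ hm => S.inner_J_ne' hm.ne')
    (fun _ hm => S.inner_J_J_ne hm.ne') h

lemma norm_map_a (n : ℕ) : ‖V (S.a n)‖ ≤ 2 := by
  have h := S.inner_self n
  have h' : ‖V (S.a n)‖ ^ 2 = 2 := by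
    rw [@norm_sq_eq_re_inner ℂ, h]; simp
  nlinarith [norm_nonneg (V (S.a n))]

/-- The step from `n` to `n + 1` has coefficients of size at most `2^n / 2` times components of `V
h`, which decay like `4^{-n}`; hence the factor `(1 / 2)^n`. The components are those of `V` itself
because the earlier rotations leave them unchanged. -/
lemma dist_approx_le (n : ℕ) : dist (S.approx n) (S.approx (n + 1)) ≤ 2 * S.C * (1 / 2) ^ n := by
  have hC := S.C_nonneg
  rw [dist_comm, dist_eq_norm]
  refine ContinuousLinearMap.opNorm_le_bound _ (by positivity) fun h => ?_
  have e : (S.approx (n + 1) - S.approx n) h =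
      ((((2 ^ n : ℝ) : ℂ) - 1) / 2 * ⟪V (S.a n), V h⟫_ℂ) • V (S.a n) +
      ((((2 ^ n : ℝ) : ℂ)⁻¹ - 1) / 2 * ⟪KreinSpace.J (V (S.a n)), V h⟫_ℂ) •
        KreinSpace.J (V (S.a n)) := by
    rw [_root_.sub_apply, approx_succ_apply, hyperbolicRotation_apply, inner_approx, inner_J_approx]
    abel
  have h1 : (1 : ℝ) ≤ 2 ^ n := one_le_pow₀ (by norm_num)
  have h2 : ‖(((2 ^ n : ℝ) : ℂ) - 1) / 2‖ ≤ 2 ^ n / 2 := by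
    have : (((2 ^ n : ℝ) : ℂ) - 1) / 2 = (((2 ^ n - 1) / 2 : ℝ) : ℂ) := by push_cast; ring
    rw [this, Complex.norm_real, Real.norm_eq_abs, abs_of_nonneg (by linarith)]
    linarith
  have h3 : ‖(((2 ^ n : ℝ) : ℂ)⁻¹ - 1) / 2‖ ≤ 2 ^ n / 2 := by
    have : (((2 ^ n : ℝ) : ℂ)⁻¹ - 1) / 2 = ((((2 ^ n)⁻¹ - 1) / 2 : ℝ) : ℂ) := by push_cast; ring
    have h4 : ((2 : ℝ) ^ n)⁻¹ ≤ 1 := inv_le_one_of_one_le₀ h1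
    have h5 : 0 < ((2 : ℝ) ^ n)⁻¹ := by positivity
    rw [this, Complex.norm_real, Real.norm_eq_abs, abs_le]
    constructor <;> linarith
  have hp := S.norm_map_a n
  have hd := S.decay n h
  have hd' := S.decay_J n h
  have e2 : (2 : ℝ) ^ n * (1 / 4) ^ n = (1 / 2) ^ n := by rw [← mul_pow]; norm_num
  rw [e]
  calc _ ≤ 2 ^ n / 2 * (S.C * (1 / 4) ^ n * ‖h‖) * 2 + 2 ^ n / 2 * (S.C * (1 / 4) ^ n * ‖h‖) * 2 := by
        refine (norm_add_le _ _).trans ?_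
        rw [norm_smul, norm_smul, norm_mul, norm_mul, norm_J]
        gcongr
    _ = 2 * S.C * (2 ^ n * (1 / 4) ^ n) * ‖h‖ := by ring
    _ = _ := by rw [e2]

lemma exists_limit : ∃ V' : H →L[ℂ] 𝒦, ∀ h, Tendsto (fun n => S.approx n h) atTop (𝓝 (V' h)) := by
  obtain ⟨V', hV'⟩ := cauchySeq_tendsto_of_complete
    (cauchySeq_of_le_geometric (1 / 2) (2 * S.C) (by norm_num) S.dist_approx_le)
  exact ⟨V', fun h => ((ContinuousLinearMap.apply ℂ 𝒦 h).continuous.tendsto V').comp hV'⟩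

lemma hyperbolicRotation_ne {m n : ℕ} (hmn : n ≠ m) (r : ℂ) :
    hyperbolicRotation (V (S.a n)) r (V (S.a m)) = V (S.a m) :=
  hyperbolicRotation_of_orthogonal r (S.inner_ne n m hmn) (S.inner_J_ne' hmn)

lemma hyperbolicRotation_J_ne {m n : ℕ} (hmn : n ≠ m) (r : ℂ) :
    hyperbolicRotation (V (S.a n)) r (KreinSpace.J (V (S.a m))) = KreinSpace.J (V (S.a m)) :=
  hyperbolicRotation_of_orthogonal r (S.inner_J_ne n m hmn) (S.inner_J_J_ne hmn)

lemma approx_of_le {m n : ℕ} (hn : n ≤ m) :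
    S.approx n (S.a m) = V (S.a m) ∧ S.approx n (S.b m) = KreinSpace.J (V (S.a m)) := by
  induction n with
  | zero => exact ⟨rfl, S.map_b m⟩
  | succ n ih =>
    obtain ⟨h1, h2⟩ := ih (by omega)
    rw [approx_succ_apply, approx_succ_apply, h1, h2]
    exact ⟨S.hyperbolicRotation_ne (by omega) _, S.hyperbolicRotation_J_ne (by omega) _⟩

/-- Only the rotation with index `m` acts on `p_m` and `J p_m`, and it first enters at stage `m +
1`; from then on the values are constant. -/
lemma approx_of_lt {m n : ℕ} (hn : m + 1 ≤ n) :
    S.approx n (S.a m) = ((2 ^ m : ℝ) : ℂ) • V (S.a m) ∧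
      S.approx n (S.b m) = ((2 ^ m : ℝ) : ℂ)⁻¹ • KreinSpace.J (V (S.a m)) := by
  induction n, hn using Nat.le_induction with
  | base =>
    obtain ⟨h1, h2⟩ := S.approx_of_le (le_refl m)
    rw [approx_succ_apply, approx_succ_apply, h1, h2]
    exact ⟨hyperbolicRotation_self _ (S.inner_self m) (S.inner_J_self m),
      hyperbolicRotation_J _ (S.inner_self m) (S.inner_J_self m)⟩
  | succ n hn ih =>
    rw [approx_succ_apply, approx_succ_apply, ih.1, ih.2, map_smul, map_smul,
      S.hyperbolicRotation_ne (by omega), S.hyperbolicRotation_J_ne (by omega)]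
    exact ⟨rfl, rfl⟩

/-- A neutral system for `V` yields a second dense map with the same indefinite inner products which
stretches the neutral vectors without bound. -/
theorem exists_stretched (hV : DenseRange V) : ∃ V' : H →L[ℂ] 𝒦, DenseRange V' ∧
    (∀ h k, kreinForm (V' h) (V' k) = kreinForm (V h) (V k)) ∧
    ∀ n, V' (S.a n) = ((2 ^ n : ℝ) : ℂ) • V (S.a n) := by
  obtain ⟨V', hV'⟩ := S.exists_limit
  have ha : ∀ m, V' (S.a m) = ((2 ^ m : ℝ) : ℂ) • V (S.a m) := fun m =>
    tendsto_nhds_unique (hV' _) (tendsto_const_nhds.congr'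
      ((eventually_ge_atTop (m + 1)).mono fun n hn => (S.approx_of_lt hn).1.symm))
  have hb : ∀ m, V' (S.b m) = ((2 ^ m : ℝ) : ℂ)⁻¹ • KreinSpace.J (V (S.a m)) := fun m =>
    tendsto_nhds_unique (hV' _) (tendsto_const_nhds.congr'
      ((eventually_ge_atTop (m + 1)).mono fun n hn => (S.approx_of_lt hn).2.symm))
  refine ⟨V', ?_, fun h k => ?_, ha⟩
  -- A vector `y` orthogonal to the range of `V'` is orthogonal to all `p_m` and `J p_m`, which are
  -- in that range up to nonzero scalars. For such `y` the rotations are invisible, so `y` is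
  -- orthogonal to the dense range of `V`.
  · have htop : (LinearMap.range V'.toLinearMap).topologicalClosure = ⊤ := by
      rw [Submodule.topologicalClosure_eq_top_iff, eq_bot_iff]
      intro y hy
      rw [Submodule.mem_orthogonal'] at hy
      have hy' : ∀ h, ⟪y, V' h⟫_ℂ = 0 := fun h => hy _ ⟨h, rfl⟩
      have hne : ∀ m : ℕ, ((2 ^ m : ℝ) : ℂ) ≠ 0 := fun m => by
        exact_mod_cast (by positivity : (2 ^ m : ℝ) ≠ 0)
      have h1 : ∀ m, ⟪y, V (S.a m)⟫_ℂ = 0 := fun m => by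
        have := hy' (S.a m)
        rw [ha, inner_smul_right] at this
        exact (mul_eq_zero.1 this).resolve_left (hne m)
      have h2 : ∀ m, ⟪y, KreinSpace.J (V (S.a m))⟫_ℂ = 0 := fun m => by
        have := hy' (S.b m)
        rw [hb, inner_smul_right] at this
        exact (mul_eq_zero.1 this).resolve_left (inv_ne_zero (hne m))
      have h3 : ∀ h, ⟪y, V h⟫_ℂ = 0 := fun h => by
        rw [← hy' h]
        refine tendsto_nhds_unique (tendsto_const_nhds.congr fun n => ?_)
          (tendsto_const_nhds.inner (hV' h))
        exact (S.inner_approx_of_orthogonal n (fun m _ => h1 m) (fun m _ => h2 m) h).symm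
      exact hV.eq_zero_of_inner_left ℂ h3
    rw [DenseRange, ← dense_closure]
    have := Submodule.dense_iff_topologicalClosure_eq_top.2 htop
    rw [LinearMap.coe_range] at this
    exact this.closure
  · refine tendsto_nhds_unique ((kreinForm_continuous.tendsto (V' h, V' k)).comp
      ((hV' h).prodMk_nhds (hV' k))) (tendsto_const_nhds.congr fun n => ?_)
    exact (S.kreinForm_approx n h k).symm

end NeutralSystem

end Hyperbolic

/-! ### Functional calculus and approximate kernel vectors near `0`. -/

section Calculus

variable {H : Type*} [NormedAddCommGroup H] [InnerProductSpace ℂ H] [CompleteSpace H]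

/-- `‖u(A) h‖²` is the quadratic form of `u²(A)`, and `g² - f²` is nonnegative on the spectrum. -/
lemma norm_cfc_apply_le {A : H →L[ℂ] H} {f g : ℝ → ℝ}
    (hf : ContinuousOn f (spectrum ℝ A)) (hg : ContinuousOn g (spectrum ℝ A))
    (hfg : ∀ t ∈ spectrum ℝ A, |f t| ≤ |g t|) (h : H) : ‖cfc f A h‖ ≤ ‖cfc g A h‖ := by
  have sq_eq : ∀ u : ℝ → ℝ, ContinuousOn u (spectrum ℝ A) →
      ‖cfc u A h‖ ^ 2 = (⟪cfc (fun t => u t * u t) A h, h⟫_ℂ).re := fun u hu => by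
    have hs : IsSelfAdjoint (cfc u A) := cfc_predicate u A
    have := hs.isSymmetric (cfc u A h) h
    simp only [ContinuousLinearMap.coe_coe] at this
    rw [cfc_mul u u A, mul_apply_eq_comp, this, @norm_sq_eq_re_inner ℂ]
    rfl
  have hnn : 0 ≤ cfc (fun t => g t * g t - f t * f t) A := cfc_nonneg fun t ht => by
    have := mul_self_le_mul_self (abs_nonneg _) (hfg t ht)
    rw [abs_mul_abs_self, abs_mul_abs_self] at this
    linarith
  have hre := ((ContinuousLinearMap.nonneg_iff_isPositive _).1 hnn).re_inner_nonneg_left h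
  rw [cfc_sub (fun t => g t * g t) (fun t => f t * f t) A (hg.mul hg) (hf.mul hf),
    _root_.sub_apply, inner_sub_left] at hre
  have hre' : 0 ≤ (⟪cfc (fun t => g t * g t) A h, h⟫_ℂ - ⟪cfc (fun t => f t * f t) A h, h⟫_ℂ).re :=
    hre
  rw [Complex.sub_re, ← sq_eq g hg, ← sq_eq f hf] at hre'
  exact (abs_le_of_sq_le_sq' (by linarith) (norm_nonneg _)).2

lemma cfc_ne_zero_of_mem_spectrum {A : H →L[ℂ] H} (hA : IsSelfAdjoint A) {f : ℝ → ℝ}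
    (hf : ContinuousOn f (spectrum ℝ A)) {t : ℝ} (ht : t ∈ spectrum ℝ A) (hft : f t ≠ 0) :
    cfc f A ≠ 0 := by
  intro h0
  have hmem : f t ∈ spectrum ℝ (cfc f A) := by
    rw [cfc_map_spectrum f A]
    exact ⟨t, ht, rfl⟩
  rw [h0, spectrum.mem_iff, sub_zero] at hmem
  exact hmem ((IsUnit.mk0 _ hft).map (algebraMap ℝ (H →L[ℂ] H)))

/-- Each term is chosen below one sixteenth of its predecessor. The bound `16^{-n}` becomes `4^{-n}`
after a square root, and the ratio `4` keeps the intervals `(t_n / 2, 3 t_n / 2)` disjoint. -/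
lemma exists_rapid_sequence {σ : Set ℝ} (hσ : ∀ ε > 0, ∃ t ∈ Set.Ioo 0 ε, t ∈ σ) :
    ∃ t : ℕ → ℝ, (∀ n, t n ∈ σ) ∧ (∀ n, 0 < t n) ∧ (∀ n, t n ≤ (1 / 16) ^ n) ∧
      ∀ m n, m < n → 4 * t n ≤ t m := by
  choose! g hg hgσ using hσ
  let t : ℕ → ℝ := fun n => Nat.rec (g 1) (fun _ s => g (s / 16)) n
  have hpos : ∀ n, 0 < t n ∧ t n ∈ σ := fun n => by
    induction n with
    | zero => exact ⟨(hg 1 one_pos).1, hgσ 1 one_pos⟩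
    | succ n ih => exact ⟨(hg _ (by linarith [ih.1])).1, hgσ _ (by linarith [ih.1])⟩
  have hstep : ∀ n, t (n + 1) < t n / 16 := fun n => (hg _ (by linarith [(hpos n).1])).2
  have hanti : Antitone t := antitone_nat_of_succ_le fun n => by
    linarith [hstep n, (hpos n).1]
  refine ⟨t, fun n => (hpos n).2, fun n => (hpos n).1, fun n => ?_, fun m n hmn => ?_⟩
  · induction n with
    | zero =>
      rw [pow_zero]
      exact (hg 1 one_pos).2.le
    | succ n ih => rw [pow_succ]; linarith [hstep n]
  · linarith [hanti (Nat.succ_le_of_lt hmn), hstep m, (hpos m).1]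

/-- The bump function with support in `[s / 2, 3 s / 2]` and maximum at `s`. -/
noncomputable def bump (s t : ℝ) : ℝ := max 0 (s / 2 - |t - s|)

lemma continuous_bump (s : ℝ) : Continuous (bump s) := by
  unfold bump; fun_prop

lemma mem_of_bump_ne_zero {s t : ℝ} (h : bump s t ≠ 0) : s / 2 < t ∧ t < 3 * s / 2 := by
  have h0 : 0 < s / 2 - |t - s| := by
    by_contra! h'
    exact h (max_eq_left h')
  have := abs_lt.1 (by linarith : |t - s| < s / 2)
  constructor <;> linarith [this.1, this.2]

/-- If the spectrum of `A` accumulates at `0` from the right, then there are vectors in mutually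
orthogonal spectral subspaces for positive parts of the spectrum which decrease to `0`. -/
theorem exists_approximate_kernel {A : H →L[ℂ] H} (hA : IsSelfAdjoint A)
    (hσ : ∀ ε > 0, ∃ t ∈ Set.Ioo 0 ε, t ∈ spectrum ℝ A) :
    ∃ a : ℕ → H, (∀ n, cfc Real.sqrt (-A) (a n) = 0) ∧ (∀ n, ‖cfc Real.sqrt A (a n)‖ = 1) ∧
      (∀ m n, m ≠ n → ⟪cfc Real.sqrt A (a m), cfc Real.sqrt A (a n)⟫_ℂ = 0) ∧
      ∀ n, ‖cfc Real.sqrt A (cfc Real.sqrt A (a n))‖ ≤ 2 * (1 / 4) ^ n := by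
  obtain ⟨t, htσ, htpos, htle, htlt⟩ := exists_rapid_sequence hσ
  set φ : ℕ → ℝ → ℝ := fun n => bump (t n) with hφ
  have hφc : ∀ n, Continuous (φ n) := fun n => continuous_bump (t n)
  -- The vectors will be `φ_n(A) k_n`, with `k_n` scaled so that applying `√A₊`, that is, forming
  -- `ψ_n(A) k_n`, gives a unit vector.
  set ψ : ℕ → ℝ → ℝ := fun n x => √x * φ n x with hψ
  have hψc : ∀ n, Continuous (ψ n) := fun n => Real.continuous_sqrt.mul (hφc n)
  have hsc : Continuous Real.sqrt := Real.continuous_sqrt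
  have hRφ : ∀ n, cfc Real.sqrt A * cfc (φ n) A = cfc (ψ n) A := fun n =>
    (cfc_mul Real.sqrt (φ n) A hsc.continuousOn (hφc n).continuousOn).symm
  have hψne : ∀ n, cfc (ψ n) A ≠ 0 := fun n => by
    refine cfc_ne_zero_of_mem_spectrum hA (hψc n).continuousOn (htσ n) ?_
    have h1 : φ n (t n) = t n / 2 := by
      simp only [hφ, bump, sub_self, abs_zero, sub_zero]
      exact max_eq_right (by linarith [htpos n])
    have h2 := htpos n
    simp only [hψ, h1]
    positivity
  have hexists : ∀ n, ∃ h, cfc (ψ n) A h ≠ 0 := fun n => by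
    by_contra! h
    exact hψne n (ContinuousLinearMap.ext h)
  choose h hh using hexists
  set c : ℕ → ℂ := fun n => ((‖cfc (ψ n) A (h n)‖⁻¹ : ℝ) : ℂ) with hc
  set k : ℕ → H := fun n => c n • h n with hk
  have hkn : ∀ n, ‖cfc (ψ n) A (k n)‖ = 1 := fun n => by
    have hpos : 0 < ‖cfc (ψ n) A (h n)‖ := norm_pos_iff.2 (hh n)
    simp only [hk, hc]
    rw [map_smul, norm_smul, Complex.norm_real, norm_inv, norm_norm, inv_mul_cancel₀ hpos.ne']
  have hRk : ∀ n, cfc Real.sqrt A (cfc (φ n) A (k n)) = cfc (ψ n) A (k n) := fun n => by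
    rw [← hRφ]; rfl
  refine ⟨fun n => cfc (φ n) A (k n), fun n => ?_, fun n => ?_, fun m n hmn => ?_, fun n => ?_⟩
  · have e : cfc Real.sqrt (-A) * cfc (φ n) A = 0 := by
      rw [← cfc_comp_neg Real.sqrt A hsc.continuousOn,
        ← cfc_mul (fun x => √(-x)) (φ n) A (hsc.comp continuous_neg).continuousOn
          (hφc n).continuousOn]
      rw [← cfc_zero ℝ A]
      refine cfc_congr fun x _ => ?_
      by_cases hx : φ n x = 0
      · simp [hx]
      · have h1 := (mem_of_bump_ne_zero hx).1
        have h2 := htpos n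
        simp [Real.sqrt_eq_zero_of_nonpos (by linarith : -x ≤ 0)]
    exact DFunLike.congr_fun e (k n)
  · rw [hRk, hkn]
  · rw [hRk, hRk]
    have hs : IsSelfAdjoint (cfc (ψ m) A) := cfc_predicate _ A
    have hsym := hs.isSymmetric (k m) (cfc (ψ n) A (k n))
    simp only [ContinuousLinearMap.coe_coe] at hsym
    have e : cfc (ψ m) A * cfc (ψ n) A = 0 := by
      rw [← cfc_mul (ψ m) (ψ n) A (hψc m).continuousOn (hψc n).continuousOn, ← cfc_zero ℝ A]
      -- Bumps with different indices have disjoint supports.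
      refine cfc_congr fun x _ => ?_
      by_contra hx
      have hm : φ m x ≠ 0 := fun h0 => hx (by simp [hψ, h0])
      have hn : φ n x ≠ 0 := fun h0 => hx (by simp [hψ, h0])
      have h1 := mem_of_bump_ne_zero hm
      have h2 := mem_of_bump_ne_zero hn
      rcases lt_or_gt_of_ne hmn with hlt | hlt
      · linarith [htlt m n hlt, h1.1, h2.2, htpos n]
      · linarith [htlt n m hlt, h2.1, h1.2, htpos m]
    have e' : cfc (ψ m) A (cfc (ψ n) A (k n)) = 0 := DFunLike.congr_fun e (k n)
    rw [hsym, e', inner_zero_right]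
  · rw [hRk]
    have hδ : (0 : ℝ) ≤ 2 * (1 / 4) ^ n := by positivity
    have e1 : cfc Real.sqrt A (cfc (ψ n) A (k n)) = cfc (fun x => √x * ψ n x) A (k n) := by
      rw [cfc_mul Real.sqrt (ψ n) A hsc.continuousOn (hψc n).continuousOn]; rfl
    have e2 : cfc (fun x => 2 * (1 / 4) ^ n * ψ n x) A (k n) =
        (2 * (1 / 4) ^ n : ℝ) • cfc (ψ n) A (k n) := by
      rw [cfc_const_mul (2 * (1 / 4) ^ n : ℝ) (ψ n) A (hψc n).continuousOn]; rfl
    have hle := norm_cfc_apply_le (A := A) (f := fun x => √x * ψ n x)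
      (g := fun x => 2 * (1 / 4) ^ n * ψ n x) (hsc.mul (hψc n)).continuousOn
      (continuous_const.mul (hψc n)).continuousOn (fun x _ => ?_) (k n)
    · rw [e1]
      refine hle.trans_eq ?_
      rw [e2, norm_smul, hkn, mul_one, Real.norm_of_nonneg hδ]
    · rw [abs_mul, abs_mul _ (ψ n x)]
      by_cases hx : φ n x = 0
      · simp [hψ, hx]
      · refine mul_le_mul_of_nonneg_right ?_ (abs_nonneg _)
        rw [abs_of_nonneg (Real.sqrt_nonneg x), abs_of_nonneg hδ]
        -- On the support of the bump `x < 3 t_n / 2 ≤ 4 · 16^{-n} = (2 · 4^{-n})²`.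
        refine Real.sqrt_le_iff.2 ⟨hδ, ?_⟩
        have h1 := (mem_of_bump_ne_zero hx).2
        have h2 : (2 * (1 / 4 : ℝ) ^ n) ^ 2 = 4 * (1 / 16) ^ n := by
          rw [mul_pow, ← pow_mul, mul_comm n 2, pow_mul]; norm_num
        rw [h2]
        linarith [htle n, htpos n]

end Calculus

/-! ### The Kreĭn space structure on a sum of two Hilbert spaces. -/

section Product

variable {E₁ E₂ : Type*} [NormedAddCommGroup E₁] [InnerProductSpace ℂ E₁]
  [NormedAddCommGroup E₂] [InnerProductSpace ℂ E₂]

/-- The symmetry `(x, y) ↦ (x, -y)` of the Hilbert space sum. -/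
noncomputable def prodSymmetry : WithLp 2 (E₁ × E₂) →L[ℂ] WithLp 2 (E₁ × E₂) :=
  (WithLp.prodContinuousLinearEquiv 2 ℂ E₁ E₂).symm.toContinuousLinearMap ∘L
    ((WithLp.fstL 2 ℂ E₁ E₂).prod (-WithLp.sndL 2 ℂ E₁ E₂))

lemma prodSymmetry_apply (x : WithLp 2 (E₁ × E₂)) :
    prodSymmetry x = WithLp.toLp 2 (x.fst, -x.snd) := rfl

variable [CompleteSpace E₁] [CompleteSpace E₂]

noncomputable instance : KreinSpace (WithLp 2 (E₁ × E₂)) where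
  J := prodSymmetry
  selfAdjoint_J := by
    rw [ContinuousLinearMap.isSelfAdjoint_iff_isSymmetric]
    intro x y
    simp [prodSymmetry_apply]
  J_mul_J := by
    ext x
    change prodSymmetry (prodSymmetry x) = x
    rw [prodSymmetry_apply, prodSymmetry_apply]
    simp only [WithLp.toLp_fst, WithLp.toLp_snd, neg_neg]
    rfl

lemma J_toLp (x : E₁) (y : E₂) :
    KreinSpace.J (WithLp.toLp 2 (x, y)) = WithLp.toLp 2 (x, -y) := rfl

end Product

/-! ### The canonical factorization of a selfadjoint operator through its positive and negative
parts. -/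

section Factorization

variable {H : Type*} [NormedAddCommGroup H] [InnerProductSpace ℂ H]

/-- The closure of the range of an operator. -/
abbrev closedRange (R : H →L[ℂ] H) : Submodule ℂ H :=
  (LinearMap.range R.toLinearMap).topologicalClosure

/-- The operator `R`, as a map into the closure of its range. -/
noncomputable def toClosedRange (R : H →L[ℂ] H) : H →L[ℂ] closedRange R :=
  R.codRestrict (closedRange R) fun h => Submodule.le_topologicalClosure _ ⟨h, rfl⟩

lemma coe_toClosedRange (R : H →L[ℂ] H) (h : H) : (toClosedRange R h : H) = R h := rfl

lemma eq_zero_of_inner_toClosedRange {R : H →L[ℂ] H} {x : closedRange R}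
    (h : ∀ k, ⟪(x : H), R k⟫_ℂ = 0) : x = 0 := by
  have hx : (x : H) ∈ (closedRange R)ᗮ := by
    rw [Submodule.orthogonal_closure, Submodule.mem_orthogonal']
    rintro _ ⟨k, rfl⟩
    exact h k
  exact Subtype.ext (inner_self_eq_zero (𝕜 := ℂ).1 (Submodule.inner_right_of_mem_orthogonal x.2 hx))

/-- The map `h ↦ (R h, R' h)` into the product of the closures of the ranges. -/
noncomputable def pairMap (R R' : H →L[ℂ] H) :
    H →L[ℂ] WithLp 2 (closedRange R × closedRange R') :=
  (WithLp.prodContinuousLinearEquiv 2 ℂ (closedRange R) (closedRange R')).symm.toContinuousLinearMap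
    ∘L ((toClosedRange R).prod (toClosedRange R'))

lemma pairMap_apply (R R' : H →L[ℂ] H) (h : H) :
    pairMap R R' h = WithLp.toLp 2 (toClosedRange R h, toClosedRange R' h) := rfl

lemma inner_pairMap (R R' : H →L[ℂ] H) (h k : H) :
    ⟪pairMap R R' h, pairMap R R' k⟫_ℂ = ⟪R h, R k⟫_ℂ + ⟪R' h, R' k⟫_ℂ := rfl

variable [CompleteSpace H]

instance (R : H →L[ℂ] H) : CompleteSpace (closedRange R) :=
  (Submodule.isClosed_topologicalClosure _).completeSpace_coe

lemma inner_pairMap_J (R R' : H →L[ℂ] H) (h k : H) :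
    ⟪pairMap R R' h, KreinSpace.J (pairMap R R' k)⟫_ℂ = ⟪R h, R k⟫_ℂ - ⟪R' h, R' k⟫_ℂ := by
  rw [sub_eq_add_neg, ← inner_neg_right]
  rfl

/-- Applied to `R k` the map gives `(R² k, 0)`, and to `R' k` it gives `(0, R'² k)`; for a
selfadjoint operator the square and the operator itself have ranges with the same orthogonal
complement. -/
lemma denseRange_pairMap {R R' : H →L[ℂ] H} (hR : IsSelfAdjoint R) (hR' : IsSelfAdjoint R')
    (hRR' : R * R' = 0) (hR'R : R' * R = 0) : DenseRange (pairMap R R') := by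
  have htop : (LinearMap.range (pairMap R R').toLinearMap).topologicalClosure = ⊤ := by
    rw [Submodule.topologicalClosure_eq_top_iff, eq_bot_iff]
    intro y hy
    rw [Submodule.mem_orthogonal'] at hy
    have hy' : ∀ h, ⟪(y.fst : H), R h⟫_ℂ + ⟪(y.snd : H), R' h⟫_ℂ = 0 := fun h => hy _ ⟨h, rfl⟩
    have key : ∀ {T : H →L[ℂ] H}, IsSelfAdjoint T → ∀ x : H, (∀ k, ⟪x, T (T k)⟫_ℂ = 0) →
        ∀ k, ⟪x, T k⟫_ℂ = 0 := by
      intro T hT x hx k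
      have hs : ∀ u v, ⟪T u, v⟫_ℂ = ⟪u, T v⟫_ℂ := hT.isSymmetric
      have h0 : T x = 0 := by
        rw [← inner_self_eq_zero (𝕜 := ℂ), hs, hx]
      rw [← hs, h0, inner_zero_left]
    have h1 : y.fst = 0 := by
      refine eq_zero_of_inner_toClosedRange (key hR _ fun k => ?_)
      have e : R' (R k) = 0 := DFunLike.congr_fun hR'R k
      simpa [e] using hy' (R k)
    have h2 : y.snd = 0 := by
      refine eq_zero_of_inner_toClosedRange (key hR' _ fun k => ?_)
      have e : R (R' k) = 0 := DFunLike.congr_fun hRR' k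
      simpa [e] using hy' (R' k)
    rw [Submodule.mem_bot]
    have : y = WithLp.toLp 2 (y.fst, y.snd) := rfl
    rw [this, h1, h2]
    rfl
  have := Submodule.dense_iff_topologicalClosure_eq_top.2 htop
  rw [LinearMap.coe_range] at this
  exact this

lemma cfc_sqrt_neg {A : H →L[ℂ] H} (hA : IsSelfAdjoint A) :
    cfc Real.sqrt (-A) = cfc (fun t => √(-t)) A :=
  (cfc_comp_neg Real.sqrt A Real.continuous_sqrt.continuousOn).symm

lemma cfc_sqrt_mul_cfc_sqrt_neg {A : H →L[ℂ] H} (hA : IsSelfAdjoint A) :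
    cfc Real.sqrt A * cfc Real.sqrt (-A) = 0 := by
  rw [cfc_sqrt_neg hA, ← cfc_mul Real.sqrt (fun t => √(-t)) A Real.continuous_sqrt.continuousOn
    (Real.continuous_sqrt.comp continuous_neg).continuousOn, ← cfc_zero ℝ A]
  refine cfc_congr fun t _ => ?_
  rcases le_total t 0 with ht | ht
  · simp [Real.sqrt_eq_zero_of_nonpos ht]
  · simp [Real.sqrt_eq_zero_of_nonpos (neg_nonpos.2 ht)]

/-- `Real.sqrt` vanishes on negative numbers, so the two roots belong to the positive and negative
parts, and this is `A = A₊ - A₋`. -/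
lemma cfc_sqrt_sq_sub {A : H →L[ℂ] H} (hA : IsSelfAdjoint A) :
    cfc Real.sqrt A * cfc Real.sqrt A - cfc Real.sqrt (-A) * cfc Real.sqrt (-A) = A := by
  have c1 : ContinuousOn Real.sqrt (spectrum ℝ A) := Real.continuous_sqrt.continuousOn
  have c2 : ContinuousOn (fun t => √(-t)) (spectrum ℝ A) :=
    (Real.continuous_sqrt.comp continuous_neg).continuousOn
  rw [cfc_sqrt_neg hA, ← cfc_mul Real.sqrt Real.sqrt A c1 c1,
    ← cfc_mul (fun t => √(-t)) (fun t => √(-t)) A c2 c2,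
    ← cfc_sub (fun t => √t * √t) (fun t => √(-t) * √(-t)) A (c1.mul c1) (c2.mul c2)]
  conv_rhs => rw [← cfc_id ℝ A]
  refine cfc_congr fun t _ => ?_
  rcases le_total t 0 with ht | ht
  · simp [Real.sqrt_eq_zero_of_nonpos ht, Real.mul_self_sqrt (neg_nonneg.2 ht)]
  · simp [Real.sqrt_eq_zero_of_nonpos (neg_nonpos.2 ht), Real.mul_self_sqrt ht]

/-- If the spectrum of `A` accumulates at `0` from both sides, then the canonical factorization of
`A` through a Krein space has a neutral system. -/
theorem exists_neutralSystem {A : H →L[ℂ] H} (hA : IsSelfAdjoint A)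
    (hpos : ∀ ε > 0, ∃ t ∈ Set.Ioo 0 ε, t ∈ spectrum ℝ A)
    (hneg : ∀ ε > 0, ∃ t ∈ Set.Ioo 0 ε, t ∈ spectrum ℝ (-A)) :
    Nonempty (NeutralSystem (pairMap (cfc Real.sqrt A) (cfc Real.sqrt (-A)))) := by
  obtain ⟨a, ha0, ha1, ha, had⟩ := exists_approximate_kernel hA hpos
  obtain ⟨b, hb0, hb1, hb, hbd⟩ := exists_approximate_kernel hA.neg hneg
  rw [neg_neg] at hb0
  set R := cfc Real.sqrt A
  set R' := cfc Real.sqrt (-A)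
  have hR : ∀ x y, ⟪R x, y⟫_ℂ = ⟪x, R y⟫_ℂ :=
    (cfc_predicate Real.sqrt A : IsSelfAdjoint R).isSymmetric
  have hR' : ∀ x y, ⟪R' x, y⟫_ℂ = ⟪x, R' y⟫_ℂ :=
    (cfc_predicate Real.sqrt (-A) : IsSelfAdjoint R').isSymmetric
  have e1 : ∀ n, R (a n + b n) = R (a n) := fun n => by rw [map_add, hb0, add_zero]
  have e2 : ∀ n, R' (a n + b n) = R' (b n) := fun n => by rw [map_add, ha0, zero_add]
  have na : ∀ n, ⟪R (a n), R (a n)⟫_ℂ = 1 := fun n => by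
    rw [inner_self_eq_norm_sq_to_K, ha1]; simp
  have nb : ∀ n, ⟪R' (b n), R' (b n)⟫_ℂ = 1 := fun n => by
    rw [inner_self_eq_norm_sq_to_K, hb1]; simp
  have da : ∀ n h, ‖⟪R (a n), R h⟫_ℂ‖ ≤ 2 * (1 / 4) ^ n * ‖h‖ := fun n h => by
    rw [← hR]
    exact (norm_inner_le_norm _ _).trans (mul_le_mul_of_nonneg_right (had n) (norm_nonneg h))
  have db : ∀ n h, ‖⟪R' (b n), R' h⟫_ℂ‖ ≤ 2 * (1 / 4) ^ n * ‖h‖ := fun n h => by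
    rw [← hR']
    exact (norm_inner_le_norm _ _).trans (mul_le_mul_of_nonneg_right (hbd n) (norm_nonneg h))
  -- The neutral vector is `(R a_n, R' b_n)`, a sum of a positive and a negative unit vector;
  -- flipping the sign of `b_n` realizes `J`. The constant `4` adds the bounds `2 · 4^{-n}` of the
  -- two components.
  refine ⟨{
    a := fun n => a n + b n
    b := fun n => a n - b n
    map_b := fun n => ?_
    inner_self := fun n => ?_
    inner_J_self := fun n => ?_
    inner_ne := fun m n hmn => ?_
    inner_J_ne := fun m n hmn => ?_
    C := 4
    C_nonneg := by norm_num
    decay := fun n h => ?_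
    decay_J := fun n h => ?_ }⟩
  · rw [pairMap_apply, pairMap_apply, J_toLp]
    have f1 : toClosedRange R (a n - b n) = toClosedRange R (a n + b n) := Subtype.ext (by
      rw [coe_toClosedRange, coe_toClosedRange, e1, map_sub, hb0, sub_zero])
    have f2 : toClosedRange R' (a n - b n) = -toClosedRange R' (a n + b n) := Subtype.ext (by
      rw [Submodule.coe_neg, coe_toClosedRange, coe_toClosedRange, e2, map_sub, ha0, zero_sub])
    rw [f1, f2]
  · rw [inner_pairMap, e1, e2, na, nb]; norm_num
  · rw [inner_pairMap_J, e1, e2, na, nb, sub_self]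
  · rw [inner_pairMap, e1, e2, e1, e2, ha m n hmn, hb m n hmn, add_zero]
  · rw [inner_pairMap_J, e1, e2, e1, e2, ha m n hmn, hb m n hmn, sub_zero]
  · rw [inner_pairMap, e1, e2]
    exact (norm_add_le _ _).trans (by linarith [da n h, db n h])
  · rw [inner_J_left, inner_pairMap_J, e1, e2]
    exact (norm_sub_le _ _).trans (by linarith [da n h, db n h])

end Factorization

/-! ### Inequivalent factorizations when the spectrum accumulates at `0` from both sides. -/

section Inequivalent

/-- If the spectrum of the selfadjoint operator `A` accumulates at `0` from both sides, then `A` has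
two dense factorizations through a Krein space which no bounded operator connects. -/
theorem exists_inequivalent {H : Type} [NormedAddCommGroup H] [InnerProductSpace ℂ H]
    [CompleteSpace H] {A : H →L[ℂ] H} (hA : IsSelfAdjoint A)
    (hpos : ∀ ε > 0, ∃ t ∈ Set.Ioo 0 ε, t ∈ spectrum ℝ A)
    (hneg : ∀ ε > 0, ∃ t ∈ Set.Ioo 0 ε, t ∈ spectrum ℝ (-A)) :
    ∃ (𝒦 : Type) (_ : NormedAddCommGroup 𝒦) (_ : InnerProductSpace ℂ 𝒦) (_ : CompleteSpace 𝒦)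
      (_ : KreinSpace 𝒦) (V V' : H →L[ℂ] 𝒦), DenseRange V ∧ DenseRange V' ∧
      (∀ h k, kreinForm (V h) (V k) = ⟪k, A h⟫_ℂ) ∧ (∀ h k, kreinForm (V' h) (V' k) = ⟪k, A h⟫_ℂ) ∧
      ¬ ∃ Φ : 𝒦 →L[ℂ] 𝒦, ∀ h, Φ (V h) = V' h := by
  obtain ⟨S⟩ := exists_neutralSystem hA hpos hneg
  set R := cfc Real.sqrt A with hRdef
  set R' := cfc Real.sqrt (-A) with hR'def
  have hR : IsSelfAdjoint R := cfc_predicate Real.sqrt A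
  have hR' : IsSelfAdjoint R' := cfc_predicate Real.sqrt (-A)
  have hRR' : R * R' = 0 := cfc_sqrt_mul_cfc_sqrt_neg hA
  have hR'R : R' * R = 0 := by
    have := congrArg star hRR'
    rwa [star_mul, star_zero, hR.star_eq, hR'.star_eq] at this
  have hsub : R * R - R' * R' = A := cfc_sqrt_sq_sub hA
  have hV := denseRange_pairMap hR hR' hRR' hR'R
  have hform : ∀ h k, kreinForm (pairMap R R' h) (pairMap R R' k) = ⟪k, A h⟫_ℂ := fun h k => by
    have s1 : ⟪R k, R h⟫_ℂ = ⟪k, R (R h)⟫_ℂ := hR.isSymmetric k (R h)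
    have s2 : ⟪R' k, R' h⟫_ℂ = ⟪k, R' (R' h)⟫_ℂ := hR'.isSymmetric k (R' h)
    rw [kreinForm, inner_pairMap_J, s1, s2, ← inner_sub_right, ← hsub]
    rfl
  obtain ⟨V', hV', hform', hstretch⟩ := S.exists_stretched hV
  refine ⟨_, _, _, inferInstance, inferInstance, pairMap R R', V', hV, hV', hform,
    fun h k => (hform' h k).trans (hform h k), ?_⟩
  rintro ⟨Φ, hΦ⟩
  -- A connecting operator would stretch the nonzero vector `p_n` by `2^n > ‖Φ‖`.
  obtain ⟨n, hn⟩ := pow_unbounded_of_one_lt ‖Φ‖ (one_lt_two : (1 : ℝ) < 2)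
  have hp : 0 < ‖pairMap R R' (S.a n)‖ := by
    rw [norm_pos_iff]
    intro h0
    have := S.inner_self n
    rw [h0, inner_zero_left] at this
    norm_num at this
  have hle := Φ.le_opNorm (pairMap R R' (S.a n))
  rw [hΦ, hstretch, norm_smul, Complex.norm_real, Real.norm_of_nonneg (by positivity)] at hle
  exact absurd (le_of_mul_le_mul_right hle hp) (not_le.2 hn)

lemma exists_mem_spectrum_of_not_subset {A : Type*} [Ring A] [Algebra ℂ A] {a : A} {S : Set ℝ}
    (h : ¬ (fun t : ℝ => (t : ℂ)) '' S ⊆ resolventSet ℂ a) : ∃ t ∈ S, t ∈ spectrum ℝ a := by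
  by_contra! h'
  refine h ?_
  rintro _ ⟨t, ht, rfl⟩
  have := h' t ht
  rw [← spectrum.algebraMap_mem_iff ℂ] at this
  exact not_not.1 this

/-- If all minimal Kolmogorov decompositions are unitarily equivalent, then every Gram operator has
a one-sided spectral gap at `0`. -/
theorem gap_of_unique {X : Type} {K L : X → X → ℂ}
    (huniq : ∀ (𝒦 : Type) [NormedAddCommGroup 𝒦] [InnerProductSpace ℂ 𝒦] [CompleteSpace 𝒦]
      [KreinSpace 𝒦] (V V' : (X →₀ ℂ) →ₗ[ℂ] 𝒦), IsKolmogorov K V → IsKolmogorov K V' →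
      ∃ Φ : 𝒦 →L[ℂ] 𝒦, ∀ f, Φ (V f) = V' f)
    (hL : IsPosDefKernel L) (h₁ : KernelLE (-L) K) (h₂ : KernelLE K L) :
    ∃ ε : ℝ, 0 < ε ∧
      ((fun t : ℝ => (t : ℂ)) '' Set.Ioo 0 ε ⊆ resolventSet ℂ (gramOperator hL h₁ h₂) ∨
        (fun t : ℝ => (t : ℂ)) '' Set.Ioo (-ε) 0 ⊆ resolventSet ℂ (gramOperator hL h₁ h₂)) := by
  by_contra! hno
  have hpos : ∀ ε > 0, ∃ t ∈ Set.Ioo 0 ε, t ∈ spectrum ℝ (gramOperator hL h₁ h₂) :=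
    fun ε hε => exists_mem_spectrum_of_not_subset (hno ε hε).1
  have hneg : ∀ ε > 0, ∃ t ∈ Set.Ioo 0 ε, t ∈ spectrum ℝ (-gramOperator hL h₁ h₂) := by
    intro ε hε
    obtain ⟨t, ht, hmem⟩ := exists_mem_spectrum_of_not_subset (hno ε hε).2
    refine ⟨-t, ⟨by linarith [ht.2], by linarith [ht.1]⟩, ?_⟩
    rw [← spectrum.neg_eq, Set.mem_neg, neg_neg]
    exact hmem
  obtain ⟨𝒦, _, _, _, _, W, W', dW, dW', fW, fW', hΦ⟩ :=
    exists_inequivalent (isSelfAdjoint_gramOperator hL h₁ h₂) hpos hneg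
  have kol : ∀ U : HilbertOf hL →L[ℂ] 𝒦, DenseRange U →
      (∀ h k, kreinForm (U h) (U k) = ⟪k, gramOperator hL h₁ h₂ h⟫_ℂ) →
      IsKolmogorov K (U.toLinearMap ∘ₗ toHilbert hL) := fun U dU fU =>
    ⟨dU.comp (denseRange_toHilbert hL) U.continuous, fun f g =>
      (fU _ _).trans (inner_gramOperator hL h₁ h₂ f g)⟩
  obtain ⟨Φ, h⟩ := huniq 𝒦 _ _ (kol W dW fW) (kol W' dW' fW')
  refine hΦ ⟨Φ, fun x => ?_⟩
  exact (denseRange_toHilbert hL).induction_on (p := fun x => Φ (W x) = W' x) x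
    (isClosed_eq (by fun_prop) (by fun_prop)) h

end Inequivalent

end KreinMoment

/-! ### The equivalence for GNS functionals. -/

open KreinMoment
theorem mainTheorem6 (N : ℕ) (s : FreeMonoid (Fin N) → ℂ)
    (hs : ∃ Z : NCPoly N →ₗ[ℂ] ℂ, IsGNSFunctional Z ∧ HasMoments Z s) :
    ((∃! Z : NCPoly N →ₗ[ℂ] ℂ, IsGNSFunctional Z ∧ HasMoments Z s) ∧
      ∀ Z : NCPoly N →ₗ[ℂ] ℂ, IsGNSFunctional Z → HasMoments Z s → UniqueGNSData Z) ↔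
    ∀ (L : FreeMonoid (Fin N) → FreeMonoid (Fin N) → ℂ) (hL : IsPosDefKernel L)
      (h₁ : KernelLE (-L) (hankelKernel s)) (h₂ : KernelLE (hankelKernel s) L),
      ∃ ε : ℝ, 0 < ε ∧
        ((fun t : ℝ => (t : ℂ)) '' Set.Ioo 0 ε ⊆ resolventSet ℂ (gramOperator hL h₁ h₂) ∨
          (fun t : ℝ => (t : ℂ)) '' Set.Ioo (-ε) 0 ⊆
            resolventSet ℂ (gramOperator hL h₁ h₂)) := by
  obtain ⟨Z, hZ, hZs⟩ := hs
  constructor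
  · rintro ⟨-, huniq⟩ L hL h₁ h₂
    refine gap_of_unique (fun 𝒦 _ _ _ _ V V' hV hV' => ?_) hL h₁ h₂
    have := huniq Z hZ hZs 𝒦 𝒦 (hV.gnsData hZs hZ.1) (hV'.gnsData hZs hZ.1)
    obtain ⟨Φ, -, hΦ⟩ := (GNSData.unitarilyEquivalent_iff _ _).1 this
    refine ⟨Φ, fun f => ?_⟩
    rw [← hV.vec_gnsData hZs hZ.1, hΦ, hV'.vec_gnsData]
  · intro hgap
    -- Existence is the hypothesis and the moments determine the functional; the gap is needed only
    -- for the data.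
    refine ⟨⟨Z, ⟨hZ, hZs⟩, fun Z' hZ' => hZ'.2.unique hZs⟩, ?_⟩
    intro Z' hZ' hZs' K₁ K₂ _ _ _ _ _ _ _ _ D₁ D₂
    rw [GNSData.unitarilyEquivalent_iff]
    exact (D₁.isKolmogorov hZs' hZ'.1).exists_unitary_of_gap (hZs'.isHermitianKernel hZ'.1) hgap
      (D₂.isKolmogorov hZs' hZ'.1)
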